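/- **Theorem 4.3.** Let $0<q<1$, $(a;p)_n=\prod_{j=0}^{n-1}(1-ap^j)$, $(a_1,a_2;p)_n=(a_1;p)_n(a_2;p)_n$, $\eta=\tfrac12(q^{1/4}+q^{-1/4})$ and $\gamma=\dfrac{2q^{1/4}}{1-q}$. Write $x=\tfrac12(z+1/z)\in\mathbb C$ with $z=e^{i\theta}$, and $\breve f(z)=f(x)$. The Askey–Wilson operator is $$\mathcal D_qf(x)=\frac{\breve f(q^{1/2}z)-\breve f(q^{-1/2}z)}{(q^{1/2}-q^{-1/2})(z-1/z)/2}$$ (its limit at $x=\pm1$). Put $\rho_0=1$ and $\rho_n(x)=(1+e^{2i\theta})(-q^{2-n}e^{2i\theta};q^2)_{n-1}e^{-in\theta}$ for $n\ge1$. For $|w|<1$ put $$\mathcal E_q(x;w)=\frac{(w^2;q^2)_\infty}{(qw^2;q^2)_\infty}\sum_{n\ge0}\frac{(-iw)^n}{(q;q)_n}q^{n^2/4}\left(-ie^{i\theta}q^{(1-n)/2},-ie^{-i\theta}q^{(1-n)/2};q\right)_n ,$$ and $C_q(x;w)=\tfrac12\left(\mathcal E_q(x;iw)+\mathcal E_q(x;-iw)\right)$.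 Let $\widetilde w_1$ be the smallest positive zero of $C_q(\eta;\cdot)$, where for real $w$ with $|w|\ge1$ the function is given by its meromorphic continuation $C_q(\eta;w)=\dfrac{(-iw;q^{1/2})_\infty+(iw;q^{1/2})_\infty}{2(-qw^2;q^2)_\infty}$. Define $\mathcal E_n(x;q)$ and $\widetilde E_n(x;q)$ by the power series at $w=0$ $$\sum_{n\ge0}\mathcal E_n(x;q)w^n=\frac{\mathcal E_q(x;w)}{\mathcal E_q(\eta;w)+\mathcal E_q(\eta;-w)},\qquad \sum_{n\ge0}\widetilde E_n(x;q)w^n=\frac{2\,\mathcal E_q(\eta;-w)\,\mathcal E_q(x;w)}{\mathcal E_q(\eta;w)+\mathcal E_q(\eta;-w)} .$$ Say that an entire function $f$ has $q$-exponential growth of order $k$ and type $\alpha$ (real numbers) if for some $K>0$, $|f(x)|<K|x|^{\alpha}\exp\left(\frac{k\ln^2|x|}{2\ln^2q}\right)$ for all $x\ne0$. Let $f$ be entire, of $q$-exponential growth of some order $k<2\ln q^{-1}$ (and any type), or of order $2\ln q^{-1}$ and some type $\alpha<\frac{2\ln2}{\ln q^{-1}}$. Then, for all $x\in\mathbb C$,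 $$f(x)=\sum_{k=0}^\infty f_k\,\rho_k(x),\qquad f_k=\frac{q^{(k^2-k)/4}(1-q)^k}{2^k(q;q)_k}\,\mathcal D_q^kf(0),$$ with absolute convergence. If moreover $$\limsup_{n\to\infty}\ \frac{1-q}{2}\sqrt[n]{|\mathcal D_q^nf(0)|\,q^{-n/4}}=\tau,\qquad 0<\tau<\min(1,\widetilde w_1),$$ then, for all $x\in\mathbb C$, $$f(x)=\sum_{k=0}^{\infty}\gamma^{-2k-1}\widetilde E_{2k+1}(x;q)\,\mathcal D_q^{2k+1}f(0)+2\sum_{k=0}^{\infty}\gamma^{-2k}\mathcal E_{2k}(x;q)\,\mathcal D_q^{2k}f(\eta),$$ both series being absolutely convergent. -/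

import Mathlib

open Filter Topology

noncomputable section

namespace AskeyWilsonEuler

/-- The finite `q`-shifted factorial `(a; q)_n = ∏_{j < n} (1 - a q^j)`. -/
def qPoch (a q : ℂ) (n : ℕ) : ℂ := ∏ j ∈ Finset.range n, (1 - a * q ^ j)

/-- The infinite `q`-shifted factorial `(a; q)_∞`. -/
def qPochInf (a q : ℂ) : ℂ := ∏' j : ℕ, (1 - a * q ^ j)

/-- A number `z = e^{iθ}` with `x = cos θ = (z + 1/z) / 2`. All expressions below in which it is
used are invariant under the exchange of the two solutions `z` and `1/z`. -/
def expAngle (x : ℂ) : ℂ := x + (x ^ 2 - 1) ^ (1 / 2 : ℂ)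

lemma expAngle_mul (x : ℂ) : expAngle x * (x - (x ^ 2 - 1) ^ (1 / 2 : ℂ)) = 1 := by
  have h : ((x ^ 2 - 1) ^ (1 / 2 : ℂ)) ^ 2 = x ^ 2 - 1 := by
    simp [one_div, ← Complex.cpow_nat_mul]
  unfold expAngle
  linear_combination -h

lemma expAngle_ne_zero (x : ℂ) : expAngle x ≠ 0 := left_ne_zero_of_mul_eq_one (expAngle_mul x)

lemma expAngle_add_inv (x : ℂ) : (expAngle x + (expAngle x)⁻¹) / 2 = x := by
  rw [inv_eq_of_mul_eq_one_right (expAngle_mul x)]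
  unfold expAngle
  ring

/-- The Askey–Wilson divided difference operator
`𝓓_q f (x) = (f̆(q^{1/2} z) - f̆(q^{-1/2} z)) / (i (q^{1/2} - q^{-1/2}) sin θ)`, where
`x = cos θ = (z + 1/z) / 2`, `z = e^{iθ}`, `f̆(z) = f((z + 1/z) / 2)` and `i sin θ = (z - 1/z) / 2`.
At `x = ±1`, where the quotient is `0 / 0`, it is given its limit for entire `f`. -/
def askeyWilson (q : ℝ) (f : ℂ → ℂ) (x : ℂ) : ℂ :=
  let s : ℂ := ((q ^ (1 / 2 : ℝ) : ℝ) : ℂ)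
  let z : ℂ := expAngle x
  if x ^ 2 = 1 then deriv f (x * ((s + s⁻¹) / 2))
  else (f ((s * z + (s * z)⁻¹) / 2) - f ((s⁻¹ * z + (s⁻¹ * z)⁻¹) / 2)) /
    ((s - s⁻¹) * ((z - z⁻¹) / 2))

/-- The Askey–Wilson quotient does not depend on the choice of `z`. -/
lemma askeyWilson_eq (q : ℝ) (f : ℂ → ℂ) (z : ℂ) (hz : z ≠ 0) (hz2 : z ^ 2 ≠ 1) :
    askeyWilson q f ((z + z⁻¹) / 2) =
      (f ((((q ^ (1 / 2 : ℝ) : ℝ) : ℂ) * z + (((q ^ (1 / 2 : ℝ) : ℝ) : ℂ) * z)⁻¹) / 2) -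
        f ((((q ^ (1 / 2 : ℝ) : ℝ) : ℂ)⁻¹ * z + (((q ^ (1 / 2 : ℝ) : ℝ) : ℂ)⁻¹ * z)⁻¹) / 2)) /
      ((((q ^ (1 / 2 : ℝ) : ℝ) : ℂ) - ((q ^ (1 / 2 : ℝ) : ℝ) : ℂ)⁻¹) * ((z - z⁻¹) / 2)) := by
  have hx : ((z + z⁻¹) / 2) ^ 2 ≠ 1 := by
    intro h
    have h1 : (z - z⁻¹) ^ 2 = 0 := by
      have : z * z⁻¹ = 1 := mul_inv_cancel₀ hz
      linear_combination 4 * h - 4 * this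
    have h2 : z - z⁻¹ = 0 := by simpa using h1
    apply hz2
    have : z * z⁻¹ = 1 := mul_inv_cancel₀ hz
    linear_combination z * h2 + this
  unfold askeyWilson
  simp only [hx, if_false]
  set x := (z + z⁻¹) / 2 with hxd
  set u := expAngle x with hu
  have hu0 : u ≠ 0 := expAngle_ne_zero x
  have hux : (u + u⁻¹) / 2 = (z + z⁻¹) / 2 := expAngle_add_inv x
  have hcase : u = z ∨ u = z⁻¹ := by
    have h1 : (u - z) * (u - z⁻¹) = 0 := by
      have e1 : u * u⁻¹ = 1 := mul_inv_cancel₀ hu0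
      have e2 : z * z⁻¹ = 1 := mul_inv_cancel₀ hz
      linear_combination 2 * u * hux + e2 - e1
    rcases mul_eq_zero.mp h1 with h | h
    · exact Or.inl (sub_eq_zero.mp h)
    · exact Or.inr (sub_eq_zero.mp h)
  rcases hcase with h | h
  · rw [h]
  · rw [h]
    set s : ℂ := ((q ^ (1 / 2 : ℝ) : ℝ) : ℂ)
    have a1 : (s * z⁻¹ + (s * z⁻¹)⁻¹) / 2 = (s⁻¹ * z + (s⁻¹ * z)⁻¹) / 2 := by
      simp only [mul_inv, inv_inv]; ring
    have a2 : (s⁻¹ * z⁻¹ + (s⁻¹ * z⁻¹)⁻¹) / 2 = (s * z + (s * z)⁻¹) / 2 := by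
      simp only [mul_inv, inv_inv]; ring
    rw [a1, a2, inv_inv, ← neg_sub z z⁻¹, neg_div, mul_neg, div_neg, ← neg_div, neg_sub]

/-- The basis `ρ_n(cos θ) = (1 + e^{2iθ}) (-q^{2-n} e^{2iθ}; q²)_{n-1} e^{-inθ}` for `n ≥ 1`,
and `ρ_0 = 1`. -/
def rho (q : ℝ) (n : ℕ) (x : ℂ) : ℂ :=
  if n = 0 then 1
  else (1 + expAngle x ^ 2) *
    qPoch (-((q : ℂ) ^ (2 - (n : ℤ)) * expAngle x ^ 2)) ((q : ℂ) ^ 2) (n - 1) *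
    (expAngle x)⁻¹ ^ n

/-- The `q`-exponential function of Ismail and Zhang, for `|w| < 1`:
`𝓔_q(cos θ; w) = (w²; q²)_∞ / (q w²; q²)_∞ *
  ∑_n (-i w)^n / (q; q)_n q^{n²/4} (-i e^{iθ} q^{(1-n)/2}, -i e^{-iθ} q^{(1-n)/2}; q)_n`.
The series is only meant (and only used) for `|w| < 1`, where it converges. -/
def qExp (q : ℝ) (x w : ℂ) : ℂ :=
  qPochInf (w ^ 2) ((q : ℂ) ^ 2) / qPochInf ((q : ℂ) * w ^ 2) ((q : ℂ) ^ 2) *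
    ∑' n : ℕ, (-Complex.I * w) ^ n / qPoch q q n * ((q ^ ((n : ℝ) ^ 2 / 4) : ℝ) : ℂ) *
      (qPoch (-Complex.I * expAngle x * ((q ^ ((1 - (n : ℝ)) / 2) : ℝ) : ℂ)) q n *
       qPoch (-Complex.I * (expAngle x)⁻¹ * ((q ^ ((1 - (n : ℝ)) / 2) : ℝ) : ℂ)) q n)

/-- The basic cosine `C_q(x; w)` for `|w| < 1`: the part of `𝓔_q(x; iw) = C_q(x; w) + i S_q(x; w)`
that is even in `w`. -/
def qCos (q : ℝ) (x w : ℂ) : ℂ := (qExp q x (Complex.I * w) + qExp q x (-(Complex.I * w))) / 2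

/-- `η = (q^{1/4} + q^{-1/4}) / 2`. -/
def eta (q : ℝ) : ℝ := (q ^ (1 / 4 : ℝ) + q ^ (-(1 / 4) : ℝ)) / 2

/-- The function `w ↦ C_q(η; w)` on the whole real line. For `|w| < 1` it is `qCos`. The series
there diverges for `|w| ≥ 1`, and `C_q(η; ·)` stands for the meromorphic continuation
`((-iw; q^{1/2})_∞ + (iw; q^{1/2})_∞) / (2 (-q w²; q²)_∞)` (which has no real poles). -/
def qCosEta (q w : ℝ) : ℂ :=
  if |w| < 1 then qCos q (eta q) w
  else (qPochInf (-Complex.I * w) ((q ^ (1 / 2 : ℝ) : ℝ) : ℂ) +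
      qPochInf (Complex.I * w) ((q ^ (1 / 2 : ℝ) : ℝ) : ℂ)) /
    (2 * qPochInf (-(q : ℂ) * (w : ℂ) ^ 2) ((q : ℂ) ^ 2))

/-- Suslov's `q`-Euler polynomials: `𝓔_n(x; q)` is the coefficient of `w^n` in the Taylor series at
`w = 0` of `𝓔_q(x; w) / (𝓔_q(η; w) + 𝓔_q(η; -w))`. -/
def eulerS (q : ℝ) (n : ℕ) (x : ℂ) : ℂ :=
  iteratedDeriv n (fun w : ℂ => qExp q x w / (qExp q (eta q) w + qExp q (eta q) (-w))) 0 /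
    (n.factorial : ℂ)

/-- The `q`-Euler polynomials `Ẽ_n(x; q)`: the coefficient of `w^n` in the Taylor series at `w = 0`
of `2 𝓔_q(η; -w) 𝓔_q(x; w) / (𝓔_q(η; w) + 𝓔_q(η; -w))`. -/
def eulerT (q : ℝ) (n : ℕ) (x : ℂ) : ℂ :=
  iteratedDeriv n (fun w : ℂ => 2 * qExp q (eta q) (-w) * qExp q x w /
    (qExp q (eta q) w + qExp q (eta q) (-w))) 0 / (n.factorial : ℂ)

/-- `f` is an entire function of `q`-exponential growth of order `k` and (finite) type `α`:
`|f(x)| < K |x|^α exp(k ln²|x| / (2 ln² q))` for some `K > 0`. -/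
def IsQExpGrowth (q : ℝ) (f : ℂ → ℂ) (k α : ℝ) : Prop :=
  Differentiable ℂ f ∧ ∃ K : ℝ, 0 < K ∧ ∀ x : ℂ, x ≠ 0 →
    ‖f x‖ < K * ‖x‖ ^ α * Real.exp (k * Real.log ‖x‖ ^ 2 / (2 * Real.log q ^ 2))

/-- `γ = 2 q^{1/4} / (1 - q)`, the constant with `𝓓_q 𝓔_q(x; w) = γ w 𝓔_q(x; w)`. -/
def gam (q : ℝ) : ℝ := 2 * q ^ (1 / 4 : ℝ) / (1 - q)

/-- The coefficients `f_k = q^{(k²-k)/4} (1-q)^k / (2^k (q; q)_k) 𝓓_q^k f (0)`. -/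
def taylorCoeff (q : ℝ) (f : ℂ → ℂ) (k : ℕ) : ℂ :=
  ((q ^ (((k : ℝ) ^ 2 - k) / 4) : ℝ) : ℂ) * (1 - (q : ℂ)) ^ k / (2 ^ k * qPoch q q k) *
    (askeyWilson q)^[k] f 0

end AskeyWilsonEuler

end

/-!
The operator `𝓓_q` has two polynomial Appell sequences that matter here: the basis `ρ_n`, rescaled
to `rhoAppell q n = q^{n²/4} ρ_n / (q; q)_n`, and the polynomials `expAppell q n` that occur in
the series of `𝓔_q(x; w)`. On both, `𝓓_q` acts as `γ` times the shift (`isAppell_rhoAppell`,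
`isAppell_expPoly`). At points `(z + 1/z) / 2` whose shifts `z ↦ q^{± 1/2} z` never meet `z² = 1`
(`IsGeneric`; both `0` and `η` are of this kind) the powers of `𝓓_q` are finite combinations of
point evaluations, so they may be applied term by term to any pointwise convergent series.

**The `q`-Taylor series.** In the variable `4 x²` the even `ρ_n`, and the odd ones divided by
`2 x`, are two Newton bases with nodes `-(q^j - q^{-j})²` and `-(q^{j+1/2} - q^{-j-1/2})²`. The
Cauchy kernel splits as `1 / (ζ - x) = ζ / (ζ² - x²) + x / (ζ² - x²)`, each part is expanded in
its Newton basis, and the result is integrated over the circles of radius `q^{-m} / 2`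
(`exists_newton_coeff`). There `∏_{j<m} |4 ζ² + ν_j|` is of size `q^{-2m²}`, while `ρ_{2m}(x)` and
`f(ζ)` are of size at most `q^{-m²}` each up to geometric factors, which is exactly where the
order `2 ln q⁻¹` comes from; the type condition makes the remaining geometric factor decay. The
coefficients are then identified by applying `𝓓_q^k` at `0` (`hasSum_rhoAppell`).

**The generating function.** The `q`-Taylor expansion of the polynomials `expAppell q n` gives
`∑ expAppell q n x wⁿ = (∑ expAppell q n 0 wⁿ) (∑ rhoAppell q n x wⁿ)`. The first factor is
evaluated by the `q`-binomial theorem and cancels the prefactor of `𝓔_q`, so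
`𝓔_q(x; w) = ∑ rhoAppell q n x wⁿ` for `|w| < 1` (`hasSum_qExp`). At `x = η` a second use of the
`q`-binomial theorem gives `𝓔_q(η; w) = (-w; q^{1/2})_∞ / (q w²; q²)_∞`. Since
`|1 - w q^{j/2}| < |1 + w q^{j/2}|` for `Re w > 0`, the zeros of `𝓔_q(η; w) + 𝓔_q(η; -w)` in the
unit disk lie on the imaginary axis, and hence correspond to real zeros of `C_q(η; ·)`
(`qExp_eta_add_ne_zero`). The series defining the `q`-Euler polynomials therefore converge for
`|w| < min 1 w₁`.

**The expansion.** With `a_n = 𝓓_q^n f(0) / γ^n = O(t^n)`, `t < min 1 w₁`, one has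
`f(x) = ∑ a_n rhoAppell q n x` and `𝓓_q^k f(η) / γ^k = ∑_j a_{k+j} rhoAppell q j η`. Multiplying
out the generating functions, both sides of the assertion become sums over the absolutely
convergent family `a_{k+j} 𝓔_k(x) rhoAppell q j η` with signs that agree (`hasSum_rearrange`).
-/

open Filter Topology

noncomputable section

namespace AskeyWilsonEuler

/-! ### The Askey–Wilson operator on generic points -/

/-- The complex number `q^{1/2}`. -/
def rootC (q : ℝ) : ℂ := ((q ^ (1 / 2 : ℝ) : ℝ) : ℂ)

/-- The Joukowski map `z ↦ (z + 1/z) / 2`, i.e. `e^{iθ} ↦ cos θ`. -/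
def joukowski (z : ℂ) : ℂ := (z + z⁻¹) / 2

lemma rootC_sq {q : ℝ} (hq0 : 0 < q) : rootC q ^ 2 = q := by
  unfold rootC
  rw [← Complex.ofReal_pow, ← Real.sqrt_eq_rpow, Real.sq_sqrt hq0.le]

lemma rootC_ne_zero {q : ℝ} (hq0 : 0 < q) : rootC q ≠ 0 :=
  Complex.ofReal_ne_zero.mpr (Real.rpow_pos_of_pos hq0 _).ne'

lemma rpow_half_lt_one {q : ℝ} (hq0 : 0 < q) (hq1 : q < 1) : q ^ (1 / 2 : ℝ) < 1 :=
  Real.rpow_lt_one hq0.le hq1 (by norm_num)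

lemma rootC_sub_inv_ne_zero {q : ℝ} (hq0 : 0 < q) (hq1 : q < 1) : rootC q - (rootC q)⁻¹ ≠ 0 := by
  intro h
  have h0 := rootC_ne_zero hq0
  have h1 : rootC q ^ 2 = 1 := by
    have : rootC q * (rootC q)⁻¹ = 1 := mul_inv_cancel₀ h0
    linear_combination rootC q * h + this
  rw [rootC_sq hq0] at h1
  have : q = 1 := by exact_mod_cast h1
  linarith

lemma joukowski_sq_add {z a : ℂ} (hz : z ≠ 0) (ha : a ≠ 0) :
    4 * joukowski z ^ 2 + (a - a⁻¹) ^ 2 = (a * z + (a * z)⁻¹) * (a⁻¹ * z + (a⁻¹ * z)⁻¹) := by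
  unfold joukowski
  field_simp
  ring

/-- The points `x = (z + 1/z) / 2` such that no iterated shift `z ↦ q^{± 1/2} z` leads to the
exceptional points `±1` of the Askey–Wilson operator. There, iterates of the operator are linear
combinations of point evaluations. -/
def IsGeneric (q : ℝ) (x : ℂ) : Prop :=
  ∃ z : ℂ, z ≠ 0 ∧ x = joukowski z ∧ ∀ n : ℤ, (rootC q ^ n * z) ^ 2 ≠ 1

lemma IsGeneric.askeyWilson_eq_sub {q : ℝ} (hq0 : 0 < q) {x : ℂ} (hx : IsGeneric q x) :
    ∃ c y₁ y₂ : ℂ, IsGeneric q y₁ ∧ IsGeneric q y₂ ∧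
      ∀ f : ℂ → ℂ, askeyWilson q f x = c * (f y₁ - f y₂) := by
  obtain ⟨z, hz, rfl, hn⟩ := hx
  have hs := rootC_ne_zero hq0
  refine ⟨((rootC q - (rootC q)⁻¹) * ((z - z⁻¹) / 2))⁻¹, joukowski (rootC q * z),
    joukowski ((rootC q)⁻¹ * z), ⟨_, mul_ne_zero hs hz, rfl, fun n => ?_⟩,
    ⟨_, mul_ne_zero (inv_ne_zero hs) hz, rfl, fun n => ?_⟩, fun f => ?_⟩
  · have := hn (n + 1)
    rwa [zpow_add₀ hs, zpow_one, mul_assoc] at this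
  · have := hn (n - 1)
    rwa [zpow_sub₀ hs, zpow_one, div_eq_mul_inv, mul_assoc] at this
  · have h := askeyWilson_eq q f z hz (by simpa using hn 0)
    change askeyWilson q f ((z + z⁻¹) / 2) = _
    rw [h, div_eq_mul_inv, mul_comm]
    rfl

lemma isGeneric_zero (q : ℝ) : IsGeneric q 0 := by
  refine ⟨Complex.I, Complex.I_ne_zero, by simp [joukowski], fun n h => ?_⟩
  rw [mul_pow, Complex.I_sq] at h
  have h1 : (((((q ^ (1 / 2 : ℝ)) ^ n) ^ 2) * (-1) : ℝ) : ℂ) = ((1 : ℝ) : ℂ) := by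
    rw [← Complex.ofReal_one] at h
    push_cast
    simpa [rootC] using h
  have h2 := Complex.ofReal_injective h1
  nlinarith [sq_nonneg ((q ^ (1 / 2 : ℝ)) ^ n)]

lemma isGeneric_eta {q : ℝ} (hq0 : 0 < q) (hq1 : q < 1) : IsGeneric q (eta q) := by
  refine ⟨((q ^ (1 / 4 : ℝ) : ℝ) : ℂ), ?_, ?_, fun n h => ?_⟩
  · exact Complex.ofReal_ne_zero.mpr (Real.rpow_pos_of_pos hq0 _).ne'
  · rw [joukowski, eta, Real.rpow_neg hq0.le]; push_cast; rfl
  · have h1 : ((((q ^ (1 / 2 : ℝ)) ^ n * q ^ (1 / 4 : ℝ)) ^ 2 : ℝ) : ℂ) = ((1 : ℝ) : ℂ) := by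
      push_cast
      simpa [rootC] using h
    have h2 := Complex.ofReal_injective h1
    rw [← Real.rpow_intCast, ← Real.rpow_mul hq0.le, ← Real.rpow_add hq0,
      ← Real.rpow_natCast, ← Real.rpow_mul hq0.le] at h2
    have h5 := congrArg Real.log h2
    rw [Real.log_rpow hq0, Real.log_one, mul_eq_zero, or_iff_left (Real.log_neg hq0 hq1).ne] at h5
    have h3 : ((2 * n + 1 : ℤ) : ℝ) = 0 := by push_cast at h5 ⊢; linarith
    have h4 : 2 * n + 1 = 0 := by exact_mod_cast h3
    omega

/-- Iterates of the Askey–Wilson operator act term by term on pointwise convergent series. -/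
lemma hasSum_askeyWilson_iterate {q : ℝ} (hq0 : 0 < q) (k : ℕ) {F : ℕ → ℂ → ℂ} {f : ℂ → ℂ}
    (h : ∀ x, IsGeneric q x → HasSum (fun n => F n x) (f x)) {x : ℂ} (hx : IsGeneric q x) :
    HasSum (fun n => (askeyWilson q)^[k] (F n) x) ((askeyWilson q)^[k] f x) := by
  induction k generalizing x with
  | zero => exact h x hx
  | succ k ih =>
    obtain ⟨c, y₁, y₂, h₁, h₂, hc⟩ := hx.askeyWilson_eq_sub hq0
    simp only [Function.iterate_succ', Function.comp, hc]
    exact ((ih h₁).sub (ih h₂)).mul_left c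

lemma askeyWilson_iterate_const_mul {q : ℝ} (hq0 : 0 < q) (k : ℕ) (a : ℂ) (f : ℂ → ℂ) {x : ℂ}
    (hx : IsGeneric q x) :
    (askeyWilson q)^[k] (fun x => a * f x) x = a * (askeyWilson q)^[k] f x := by
  induction k generalizing x with
  | zero => rfl
  | succ k ih =>
    obtain ⟨c, y₁, y₂, h₁, h₂, hc⟩ := hx.askeyWilson_eq_sub hq0
    simp only [Function.iterate_succ', Function.comp, hc, ih h₁, ih h₂]
    ring

/-- A sequence of functions on which the Askey–Wilson operator acts as a multiple of the shift,
as `d/dx` does on `x ^ n / n!`. -/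
def IsAppell (q : ℝ) (P : ℕ → ℂ → ℂ) : Prop :=
  (∀ x, P 0 x = 1) ∧
    ∀ n x, IsGeneric q x → askeyWilson q (P (n + 1)) x = (gam q : ℂ) * P n x

lemma IsAppell.iterate {q : ℝ} (hq0 : 0 < q) {P : ℕ → ℂ → ℂ} (hP : IsAppell q P) (k n : ℕ) {x : ℂ}
    (hx : IsGeneric q x) :
    (askeyWilson q)^[k] (P n) x = if k ≤ n then (gam q : ℂ) ^ k * P (n - k) x else 0 := by
  induction k generalizing x with
  | zero => simp
  | succ k ih =>
    obtain ⟨c, y₁, y₂, h₁, h₂, hc⟩ := hx.askeyWilson_eq_sub hq0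
    simp only [Function.iterate_succ', Function.comp, hc, ih h₁, ih h₂]
    rcases lt_trichotomy k n with h | h | h
    · obtain ⟨d, rfl⟩ : ∃ d, n = k + d + 1 := ⟨n - k - 1, by omega⟩
      have e1 : k + d + 1 - k = d + 1 := by omega
      have e2 : k + d + 1 - (k + 1) = d := by omega
      have := hP.2 d x hx
      rw [hc] at this
      rw [if_pos h.le, if_pos h.le, if_pos (by omega), e1, e2, pow_succ, mul_assoc _ (gam q : ℂ),
        ← this]
      ring
    · subst h
      simp [hP.1]
    · rw [if_neg (by omega), if_neg (by omega), if_neg (by omega)]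
      simp

/-! ### Two Appell sequences of polynomials -/

/-- The coefficient `q^{n²/4} / (q; q)_n`. -/
def appellCoeff (q : ℝ) (n : ℕ) : ℂ := ((q ^ ((n : ℝ) ^ 2 / 4) : ℝ) : ℂ) / qPoch q q n

lemma one_sub_pow_ne_zero {q : ℝ} (hq0 : 0 < q) (hq1 : q < 1) (n : ℕ) :
    1 - (q : ℂ) ^ (n + 1) ≠ 0 := by
  have : q ^ (n + 1) < 1 := pow_lt_one₀ hq0.le hq1 (by omega)
  rw [sub_ne_zero]
  exact_mod_cast this.ne'

lemma qPoch_succ (a q : ℂ) (n : ℕ) : qPoch a q (n + 1) = qPoch a q n * (1 - a * q ^ n) := by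
  simp [qPoch, Finset.prod_range_succ]

lemma qPoch_self_succ (q : ℂ) (n : ℕ) : qPoch q q (n + 1) = qPoch q q n * (1 - q ^ (n + 1)) := by
  rw [qPoch_succ, pow_succ' q n]

lemma qPoch_self_ne_zero {q : ℝ} (hq0 : 0 < q) (hq1 : q < 1) (n : ℕ) : qPoch q q n ≠ 0 := by
  induction n with
  | zero => simp [qPoch]
  | succ n ih => rw [qPoch_self_succ]; exact mul_ne_zero ih (one_sub_pow_ne_zero hq0 hq1 n)

lemma appellCoeff_zero (q : ℝ) : appellCoeff q 0 = 1 := by simp [appellCoeff, qPoch]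

lemma appellCoeff_succ {q : ℝ} (hq0 : 0 < q) (n : ℕ) :
    appellCoeff q (n + 1) =
      appellCoeff q n * (((q ^ (1 / 4 : ℝ) : ℝ) : ℂ) * rootC q ^ n / (1 - (q : ℂ) ^ (n + 1))) := by
  have h : q ^ (((n + 1 : ℕ) : ℝ) ^ 2 / 4) =
      q ^ ((n : ℝ) ^ 2 / 4) * (q ^ (1 / 4 : ℝ) * (q ^ (1 / 2 : ℝ)) ^ n) := by
    rw [← Real.rpow_natCast (q ^ (1 / 2 : ℝ)), ← Real.rpow_mul hq0.le, ← Real.rpow_add hq0,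
      ← Real.rpow_add hq0]
    congr 1; push_cast; ring
  rw [appellCoeff, h, qPoch_self_succ, appellCoeff, rootC]
  push_cast
  rw [mul_div_mul_comm]

lemma gam_ne_zero {q : ℝ} (hq0 : 0 < q) (hq1 : q < 1) : (gam q : ℂ) ≠ 0 := by
  have : 0 < gam q := div_pos (mul_pos two_pos (Real.rpow_pos_of_pos hq0 _)) (by linarith)
  exact_mod_cast this.ne'

/-- Multiplication by `q^{n²/4} / (q; q)_n` turns a sequence with
`𝓓_q p_{n+1} = 2 (q^{(n+1)/2} - q^{-(n+1)/2}) / (q^{1/2} - q^{-1/2}) p_n` into an Appell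
sequence. -/
lemma isAppell_of_shift {q : ℝ} (hq0 : 0 < q) (hq1 : q < 1) {p : ℕ → ℂ → ℂ} (h0 : ∀ x, p 0 x = 1)
    (h : ∀ (n : ℕ) (z : ℂ), z ≠ 0 → p (n + 1) (joukowski (rootC q * z)) -
      p (n + 1) (joukowski ((rootC q)⁻¹ * z)) =
        (rootC q ^ (n + 1) - (rootC q ^ (n + 1))⁻¹) * (z - z⁻¹) * p n (joukowski z)) :
    IsAppell q (fun n x => appellCoeff q n * p n x) := by
  refine ⟨fun x => by simp [appellCoeff_zero, h0], fun n x hx => ?_⟩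
  obtain ⟨z, hz, rfl, hn⟩ := hx
  have hz2 : z ^ 2 ≠ 1 := by simpa using hn 0
  have hs := rootC_ne_zero hq0
  have hd := rootC_sub_inv_ne_zero hq0 hq1
  have hz' : z - z⁻¹ ≠ 0 := by
    intro h
    have : z * z⁻¹ = 1 := mul_inv_cancel₀ hz
    exact hz2 (by linear_combination z * h + this)
  have e : askeyWilson q (fun x => appellCoeff q (n + 1) * p (n + 1) x) (joukowski z) =
      (appellCoeff q (n + 1) * p (n + 1) (joukowski (rootC q * z)) -
        appellCoeff q (n + 1) * p (n + 1) (joukowski ((rootC q)⁻¹ * z))) /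
      ((rootC q - (rootC q)⁻¹) * ((z - z⁻¹) / 2)) := askeyWilson_eq q _ z hz hz2
  rw [e, ← mul_sub, h n z hz, appellCoeff_succ hq0]
  have h1 := one_sub_pow_ne_zero hq0 hq1 n
  have h2 := one_sub_pow_ne_zero hq0 hq1 0
  have hg : (gam q : ℂ) = 2 * ((q ^ (1 / 4 : ℝ) : ℝ) : ℂ) / (1 - (q : ℂ)) := by
    rw [gam]; push_cast; rfl
  have key : rootC q ^ n * (rootC q ^ (n + 1) - (rootC q ^ (n + 1))⁻¹) * (1 - (q : ℂ)) =
      (1 - (q : ℂ) ^ (n + 1)) * (rootC q - (rootC q)⁻¹) := by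
    rw [← rootC_sq hq0]
    field_simp
    ring
  rw [hg]
  rw [zero_add, pow_one] at h2
  rw [div_eq_iff (mul_ne_zero hd (div_ne_zero hz' two_ne_zero))]
  generalize rootC q ^ (n + 1) - (rootC q ^ (n + 1))⁻¹ = d₁ at *
  generalize rootC q - (rootC q)⁻¹ = d₂ at *
  generalize z - z⁻¹ = d₃ at *
  field_simp
  linear_combination (appellCoeff q n * ((q ^ (1 / 4 : ℝ) : ℝ) : ℂ) * p n (joukowski z)) * key

lemma rho_one (q : ℝ) (x : ℂ) : rho q 1 x = 2 * x := by
  have h := expAngle_add_inv x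
  have h0 := expAngle_ne_zero x
  simp only [rho, qPoch]
  simp only [one_ne_zero, if_false, Nat.sub_self, Finset.range_zero, Finset.prod_empty]
  have e : expAngle x * (expAngle x)⁻¹ = 1 := mul_inv_cancel₀ h0
  linear_combination 2 * h + expAngle x * e

/-- The basis in steps of two, with both new zeros explicit. -/
lemma rho_add_two {q : ℝ} (hq0 : 0 < q) (n : ℕ) (x : ℂ) :
    rho q (n + 2) x = rho q n x * (4 * x ^ 2 + (rootC q ^ n - (rootC q ^ n)⁻¹) ^ 2) := by
  have h0 := expAngle_ne_zero x
  have hs := rootC_ne_zero hq0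
  have hx : 4 * x ^ 2 + (rootC q ^ n - (rootC q ^ n)⁻¹) ^ 2 = _ :=
    (congrArg (fun y => 4 * y ^ 2 + _) (expAngle_add_inv x).symm).trans
      (joukowski_sq_add h0 (pow_ne_zero n hs))
  rw [hx]
  set z := expAngle x with hz
  have hq : (q : ℂ) = rootC q ^ 2 := (rootC_sq hq0).symm
  rcases n with _ | n
  · simp only [rho, qPoch, ← hz]
    norm_num
    field_simp
    ring
  · simp only [rho, qPoch, ← hz]
    have e1 : ∀ j : ℕ,
        (1 - -((q : ℂ) ^ (2 - ((n + 1 + 2 : ℕ) : ℤ)) * z ^ 2) * ((q : ℂ) ^ 2) ^ (j + 1)) =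
        (1 - -((q : ℂ) ^ (2 - ((n + 1 : ℕ) : ℤ)) * z ^ 2) * ((q : ℂ) ^ 2) ^ j) := by
      intro j
      have hq' : (q : ℂ) ≠ 0 := by exact_mod_cast hq0.ne'
      have : (q : ℂ) ^ (2 - ((n + 1 : ℕ) : ℤ)) =
          (q : ℂ) ^ (2 - ((n + 1 + 2 : ℕ) : ℤ)) * (q : ℂ) ^ 2 := by
        rw [← zpow_natCast, ← zpow_add₀ hq']
        congr 1
      rw [this]; ring
    have e3 : n + 1 + 2 - 1 = n + 1 + 1 := by omega
    have e4 : n + 1 - 1 = n := by omega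
    rw [e3, e4, Finset.prod_range_succ', Finset.prod_congr rfl (fun j _ => e1 j),
      Finset.prod_range_succ]
    have hq' : (q : ℂ) ≠ 0 := by exact_mod_cast hq0.ne'
    have f1 : (q : ℂ) ^ (2 - ((n + 1 : ℕ) : ℤ)) * ((q : ℂ) ^ 2) ^ n =
        rootC q ^ (n + 1) * rootC q ^ (n + 1) := by
      rw [← pow_add, ← two_mul, pow_mul, ← hq, ← pow_mul, ← zpow_natCast, ← zpow_natCast,
        ← zpow_add₀ hq']
      congr 1
      push_cast
      ring
    have f2 : (q : ℂ) ^ (2 - ((n + 1 + 2 : ℕ) : ℤ)) =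
        (rootC q ^ (n + 1))⁻¹ * (rootC q ^ (n + 1))⁻¹ := by
      rw [← mul_inv, ← pow_add, ← two_mul, pow_mul, ← hq, ← zpow_natCast, ← zpow_neg]
      congr 1
    have f3 : (q : ℂ) ^ (2 - ((n + 1 : ℕ) : ℤ)) * z ^ 2 * ((q : ℂ) ^ 2) ^ n =
        rootC q ^ (n + 1) * rootC q ^ (n + 1) * z ^ 2 := by rw [← f1]; ring
    rw [neg_mul, f3, f2]
    rw [if_neg (by omega), if_neg (by omega)]
    have hA : rootC q ^ (n + 1) ≠ 0 := pow_ne_zero _ hs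
    generalize rootC q ^ (n + 1) = A at *
    simp only [inv_pow, pow_zero, mul_one]
    field_simp
    ring

/-- The two shifts of `ρ_{n+2}` share all factors but two with `ρ_{n+1}`. -/
lemma rho_succ_shift {q : ℝ} (hq0 : 0 < q) {z : ℂ} (hz : z ≠ 0) (n : ℕ) :
    ∃ P : ℂ, rho q (n + 1) (joukowski z) = (z + z⁻¹) * P ∧
      rho q (n + 2) (joukowski (rootC q * z)) = (rootC q * z + (rootC q * z)⁻¹) *
        (rootC q ^ (n + 1) * z + (rootC q ^ (n + 1) * z)⁻¹) * P ∧
      rho q (n + 2) (joukowski ((rootC q)⁻¹ * z)) = ((rootC q)⁻¹ * z + ((rootC q)⁻¹ * z)⁻¹) *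
        ((rootC q ^ (n + 1))⁻¹ * z + ((rootC q ^ (n + 1))⁻¹ * z)⁻¹) * P := by
  have hs := rootC_ne_zero hq0
  induction n using Nat.twoStepInduction with
  | zero =>
    refine ⟨1, ?_, ?_, ?_⟩
    · rw [zero_add, rho_one, joukowski]; ring
    all_goals
      rw [rho_add_two hq0, pow_zero]
      simp only [rho, joukowski, zero_add, pow_one]
      simp
      ring
  | one =>
    refine ⟨z + z⁻¹, ?_, ?_, ?_⟩
    · rw [rho_add_two hq0]
      simp [rho, joukowski]
      ring
    all_goals
      rw [rho_add_two hq0, rho_one]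
      simp only [joukowski, pow_one]
      field_simp
      ring
  | more n ih _ =>
    obtain ⟨P, h1, h2, h3⟩ := ih
    refine ⟨P * ((rootC q ^ (n + 1) * z + (rootC q ^ (n + 1) * z)⁻¹) *
      ((rootC q ^ (n + 1))⁻¹ * z + ((rootC q ^ (n + 1))⁻¹ * z)⁻¹)), ?_, ?_, ?_⟩
    · rw [show n + 2 + 1 = n + 1 + 2 by ring, rho_add_two hq0, h1,
        joukowski_sq_add hz (pow_ne_zero _ hs)]
      ring
    · rw [rho_add_two hq0 (n + 2), h2, joukowski_sq_add (mul_ne_zero hs hz) (pow_ne_zero _ hs)]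
      have e1 : rootC q ^ (n + 2) * (rootC q * z) = rootC q ^ (n + 2 + 1) * z := by ring
      have e2 : (rootC q ^ (n + 2))⁻¹ * (rootC q * z) = (rootC q ^ (n + 1))⁻¹ * z := by
        field_simp
        ring
      rw [e1, e2]
      ring
    · rw [rho_add_two hq0 (n + 2), h3,
        joukowski_sq_add (mul_ne_zero (inv_ne_zero hs) hz) (pow_ne_zero _ hs)]
      have e1 : rootC q ^ (n + 2) * ((rootC q)⁻¹ * z) = rootC q ^ (n + 1) * z := by
        field_simp
        ring
      have e2 : (rootC q ^ (n + 2))⁻¹ * ((rootC q)⁻¹ * z) = (rootC q ^ (n + 2 + 1))⁻¹ * z := by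
        field_simp
        ring
      rw [e1, e2]
      ring

/-- The normalized basis `q^{n²/4} ρ_n / (q; q)_n`. -/
def rhoAppell (q : ℝ) (n : ℕ) (x : ℂ) : ℂ := appellCoeff q n * rho q n x

lemma isAppell_rhoAppell {q : ℝ} (hq0 : 0 < q) (hq1 : q < 1) : IsAppell q (rhoAppell q) := by
  refine isAppell_of_shift hq0 hq1 (fun x => by simp [rho]) (fun n z hz => ?_)
  have hs := rootC_ne_zero hq0
  rcases n with _ | n
  · rw [zero_add, rho_one, rho_one]
    simp only [rho, joukowski, if_true, pow_one]
    field_simp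
    ring
  · obtain ⟨P, h1, h2, h3⟩ := rho_succ_shift hq0 hz n
    rw [h1, show n + 1 + 1 = n + 2 by ring, h2, h3]
    field_simp
    ring

lemma rhoAppell_zero (q : ℝ) (x : ℂ) : rhoAppell q 0 x = 1 := by
  simp [rhoAppell, appellCoeff_zero, rho]

lemma rhoAppell_succ_at_zero {q : ℝ} (hq0 : 0 < q) (n : ℕ) : rhoAppell q (n + 1) 0 = 0 := by
  have h : rho q (n + 1) 0 = 0 := by
    induction n using Nat.twoStepInduction with
    | zero => simp [rho_one]
    | one => rw [rho_add_two hq0]; simp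
    | more n ih _ => rw [show n + 2 + 1 = n + 1 + 2 by ring, rho_add_two hq0, ih, zero_mul]
  rw [rhoAppell, h, mul_zero]

/-- The polynomials in the series of `𝓔_q(x; w)`, up to the factor `q^{n²/4} / (q; q)_n`:
`(-i)^n (-i e^{iθ} q^{(1-n)/2}, -i e^{-iθ} q^{(1-n)/2}; q)_n`, with the two factors for each `j`
multiplied out. -/
def expPoly (q : ℝ) (n : ℕ) (x : ℂ) : ℂ :=
  (-Complex.I) ^ n * ∏ j ∈ Finset.range n,
    (1 + 2 * Complex.I * (rootC q ^ (1 - (n : ℤ)) * rootC q ^ (2 * j)) * x -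
      (rootC q ^ (1 - (n : ℤ)) * rootC q ^ (2 * j)) ^ 2)

lemma one_add_joukowski_factor (a : ℂ) {z : ℂ} (hz : z ≠ 0) :
    1 + 2 * Complex.I * a * joukowski z - a ^ 2 =
      (1 + Complex.I * a * z) * (1 + Complex.I * a * z⁻¹) := by
  have : z * z⁻¹ = 1 := mul_inv_cancel₀ hz
  unfold joukowski
  linear_combination (-a ^ 2 * Complex.I ^ 2) * this - a ^ 2 * Complex.I_sq

lemma expPoly_joukowski (q : ℝ) (n : ℕ) {z : ℂ} (hz : z ≠ 0) :
    expPoly q n (joukowski z) = (-Complex.I) ^ n *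
      ((∏ j ∈ Finset.range n, (1 + Complex.I * (rootC q ^ (1 - (n : ℤ)) * rootC q ^ (2 * j)) * z)) *
      ∏ j ∈ Finset.range n,
        (1 + Complex.I * (rootC q ^ (1 - (n : ℤ)) * rootC q ^ (2 * j)) * z⁻¹)) := by
  rw [expPoly, ← Finset.prod_mul_distrib]
  simp only [one_add_joukowski_factor _ hz]

lemma rootC_zpow_shift {q : ℝ} (hq0 : 0 < q) {m : ℤ} {j : ℕ} {a : ℤ} {b : ℕ}
    (h : m + j = a + b) : rootC q ^ m * rootC q ^ j = rootC q ^ a * rootC q ^ b := by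
  have hs := rootC_ne_zero hq0
  rw [← zpow_natCast, ← zpow_natCast, ← zpow_add₀ hs, ← zpow_add₀ hs, h]

lemma expPoly_succ_shift {q : ℝ} (hq0 : 0 < q) (n : ℕ) {z : ℂ} (hz : z ≠ 0) :
    expPoly q (n + 1) (joukowski (rootC q * z)) = expPoly q n (joukowski z) *
      (-Complex.I * (1 + Complex.I * rootC q ^ (n + 1) * z) *
        (1 + Complex.I * (rootC q ^ (n + 1))⁻¹ * z⁻¹)) := by
  have hs := rootC_ne_zero hq0
  rw [expPoly_joukowski q _ (mul_ne_zero hs hz), expPoly_joukowski q _ hz, Finset.prod_range_succ,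
    Finset.prod_range_succ' (fun j => (1 + Complex.I *
      (rootC q ^ (1 - ((n + 1 : ℕ) : ℤ)) * rootC q ^ (2 * j)) * (rootC q * z)⁻¹))]
  have e1 : ∀ j : ℕ, rootC q ^ (1 - ((n + 1 : ℕ) : ℤ)) * rootC q ^ (2 * j) * rootC q =
      rootC q ^ (1 - (n : ℤ)) * rootC q ^ (2 * j) := by
    intro j
    rw [mul_assoc, ← pow_succ]
    exact rootC_zpow_shift hq0 (by push_cast; ring)
  have e2 : ∀ j : ℕ, rootC q ^ (1 - ((n + 1 : ℕ) : ℤ)) * rootC q ^ (2 * (j + 1)) * (rootC q)⁻¹ =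
      rootC q ^ (1 - (n : ℤ)) * rootC q ^ (2 * j) := by
    intro j
    rw [mul_assoc, mul_add, mul_one, pow_add, pow_two, ← mul_assoc _ (rootC q) (rootC q),
      mul_inv_cancel_right₀ hs, ← pow_succ]
    exact rootC_zpow_shift hq0 (by push_cast; ring)
  have e3 : rootC q ^ (1 - (n : ℤ)) * rootC q ^ (2 * n) = rootC q ^ (n + 1) := by
    rw [rootC_zpow_shift hq0 (a := 0) (b := n + 1) (by push_cast; ring), zpow_zero, one_mul]
  have e4 : rootC q ^ (1 - ((n + 1 : ℕ) : ℤ)) * (rootC q)⁻¹ = (rootC q ^ (n + 1))⁻¹ := by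
    rw [← zpow_natCast, ← zpow_neg, ← zpow_neg_one, ← zpow_add₀ hs]
    congr 1; push_cast; ring
  have g1 : ∀ j : ℕ, 1 + Complex.I * (rootC q ^ (1 - ((n + 1 : ℕ) : ℤ)) * rootC q ^ (2 * j)) *
      (rootC q * z) = 1 + Complex.I * (rootC q ^ (1 - (n : ℤ)) * rootC q ^ (2 * j)) * z := by
    intro j; rw [← e1]; ring
  have g2 : ∀ j : ℕ, 1 + Complex.I * (rootC q ^ (1 - ((n + 1 : ℕ) : ℤ)) * rootC q ^ (2 * (j + 1))) *
      (rootC q * z)⁻¹ = 1 + Complex.I * (rootC q ^ (1 - (n : ℤ)) * rootC q ^ (2 * j)) * z⁻¹ := by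
    intro j; rw [← e2, mul_inv]; ring
  rw [Finset.prod_congr rfl (fun j _ => g1 j), Finset.prod_congr rfl (fun j _ => g2 j), g1, e3,
    ← e4, mul_inv]
  ring

lemma isAppell_expPoly {q : ℝ} (hq0 : 0 < q) (hq1 : q < 1) :
    IsAppell q (fun n x => appellCoeff q n * expPoly q n x) := by
  refine isAppell_of_shift hq0 hq1 (fun x => by simp [expPoly]) (fun n z hz => ?_)
  have hs := rootC_ne_zero hq0
  have e1 : joukowski ((rootC q)⁻¹ * z) = joukowski (rootC q * z⁻¹) := by
    unfold joukowski
    rw [mul_inv, mul_inv, inv_inv, inv_inv]; ring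
  have e2 : joukowski z⁻¹ = joukowski z := by
    unfold joukowski
    rw [inv_inv]; ring
  rw [e1, expPoly_succ_shift hq0 n hz, expPoly_succ_shift hq0 n (inv_ne_zero hz), e2, inv_inv]
  generalize expPoly q n (joukowski z) = p
  generalize hb : rootC q ^ (n + 1) = b
  linear_combination (-p * (b - b⁻¹) * (z - z⁻¹)) * Complex.I_sq

lemma expPoly_add_two {q : ℝ} (hq0 : 0 < q) (n : ℕ) (x : ℂ) :
    expPoly q (n + 2) x = -(expPoly q n x *
      ((1 + 2 * Complex.I * (rootC q ^ (n + 1))⁻¹ * x - ((rootC q ^ (n + 1))⁻¹) ^ 2) *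
      (1 + 2 * Complex.I * rootC q ^ (n + 1) * x - (rootC q ^ (n + 1)) ^ 2))) := by
  have hs := rootC_ne_zero hq0
  have e1 : ∀ j : ℕ, rootC q ^ (1 - ((n + 2 : ℕ) : ℤ)) * rootC q ^ (2 * (j + 1)) =
      rootC q ^ (1 - (n : ℤ)) * rootC q ^ (2 * j) := fun j =>
    rootC_zpow_shift hq0 (by push_cast; ring)
  have e2 : rootC q ^ (1 - ((n + 2 : ℕ) : ℤ)) * rootC q ^ (2 * 0) = (rootC q ^ (n + 1))⁻¹ := by
    rw [mul_zero, pow_zero, mul_one, ← zpow_natCast, ← zpow_neg]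
    congr 1
  have e3 : rootC q ^ (1 - (n : ℤ)) * rootC q ^ (2 * n) = rootC q ^ (n + 1) := by
    rw [rootC_zpow_shift hq0 (a := 0) (b := n + 1) (by push_cast; ring), zpow_zero, one_mul]
  rw [expPoly, Finset.prod_range_succ', e2]
  simp only [e1]
  rw [Finset.prod_range_succ, e3, expPoly, pow_add, neg_sq, Complex.I_sq]
  ring

lemma expPoly_one (q : ℝ) (x : ℂ) : expPoly q 1 x = 2 * x := by
  simp [expPoly]
  linear_combination (-2 * x) * Complex.I_sq

lemma differentiable_expPoly (q : ℝ) (n : ℕ) : Differentiable ℂ (expPoly q n) := by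
  unfold expPoly
  fun_prop

lemma rootC_zpow_one_sub {q : ℝ} (hq0 : 0 < q) (n : ℕ) :
    ((q ^ ((1 - (n : ℝ)) / 2) : ℝ) : ℂ) = rootC q ^ (1 - (n : ℤ)) := by
  rw [rootC, ← Complex.ofReal_zpow, ← Real.rpow_intCast, ← Real.rpow_mul hq0.le]
  congr 2; push_cast; ring

lemma qExp_eq_tsum_expPoly {q : ℝ} (hq0 : 0 < q) (x w : ℂ) :
    qExp q x w = qPochInf (w ^ 2) ((q : ℂ) ^ 2) / qPochInf ((q : ℂ) * w ^ 2) ((q : ℂ) ^ 2) *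
      ∑' n : ℕ, appellCoeff q n * expPoly q n x * w ^ n := by
  rw [qExp]
  congr 2
  funext n
  have hx : expPoly q n x = _ :=
    (congrArg (expPoly q n) (expAngle_add_inv x).symm).trans
      (expPoly_joukowski q n (expAngle_ne_zero x))
  have key : ∀ u : ℂ, qPoch (-Complex.I * u * ((q ^ ((1 - (n : ℝ)) / 2) : ℝ) : ℂ)) q n =
      ∏ j ∈ Finset.range n,
        (1 + Complex.I * (rootC q ^ (1 - (n : ℤ)) * rootC q ^ (2 * j)) * u) := fun u => by
    rw [qPoch]
    refine Finset.prod_congr rfl fun j _ => ?_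
    rw [rootC_zpow_one_sub hq0, ← rootC_sq hq0, ← pow_mul]
    ring
  rw [hx, key, key, appellCoeff, mul_pow]
  ring

/-! ### Newton interpolation on the zeros of the basis -/

lemma sum_range_pow_le {q : ℝ} (hq0 : 0 < q) (hq1 : q < 1) (m : ℕ) :
    ∑ i ∈ Finset.range m, q ^ i ≤ (1 - q)⁻¹ := by
  rw [← tsum_geometric_of_lt_one hq0.le hq1]
  exact (summable_geometric_of_lt_one hq0.le hq1).sum_le_tsum _ fun i _ => by positivity

lemma prod_one_add_le {q : ℝ} (hq0 : 0 < q) (hq1 : q < 1) {a : ℝ} (ha : 0 ≤ a) (m : ℕ) :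
    ∏ i ∈ Finset.range m, (1 + a * q ^ i) ≤ Real.exp (a * (1 - q)⁻¹) := by
  calc ∏ i ∈ Finset.range m, (1 + a * q ^ i) ≤ ∏ i ∈ Finset.range m, Real.exp (a * q ^ i) :=
        Finset.prod_le_prod (fun i _ => by positivity) fun i _ => by
          rw [add_comm]; exact Real.add_one_le_exp _
    _ = Real.exp (a * ∑ i ∈ Finset.range m, q ^ i) := by rw [← Real.exp_sum, Finset.mul_sum]
    _ ≤ _ := Real.exp_le_exp.mpr (mul_le_mul_of_nonneg_left (sum_range_pow_le hq0 hq1 m) ha)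

lemma exists_le_prod_one_sub {q : ℝ} (hq0 : 0 < q) (hq1 : q < 1) :
    ∃ c : ℝ, 0 < c ∧ ∀ m, c ≤ ∏ l ∈ Finset.range m, (1 - q ^ (l + 1)) := by
  have h1 : 0 < 1 - q := by linarith
  refine ⟨Real.exp (-((1 - q)⁻¹ * (1 - q)⁻¹)), Real.exp_pos _, fun m => ?_⟩
  calc Real.exp (-((1 - q)⁻¹ * (1 - q)⁻¹))
      ≤ Real.exp (-((1 - q)⁻¹ * ∑ i ∈ Finset.range m, q ^ i)) :=
        Real.exp_le_exp.mpr (neg_le_neg (mul_le_mul_of_nonneg_left (sum_range_pow_le hq0 hq1 m)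
          (by positivity)))
    _ = ∏ l ∈ Finset.range m, Real.exp (-((1 - q)⁻¹ * q ^ l)) := by
        rw [← Real.exp_sum, Finset.sum_neg_distrib, Finset.mul_sum]
    _ ≤ _ := Finset.prod_le_prod (fun i _ => (Real.exp_pos _).le) fun l _ => by
        have hx : q ^ (l + 1) ≤ q := pow_le_of_le_one hq0.le hq1.le (by omega)
        have hx' : q ^ (l + 1) ≤ q ^ l := pow_le_pow_of_le_one hq0.le hq1.le (by omega)
        have hp : 0 < 1 - q ^ (l + 1) := by linarith
        have hl : 0 < q ^ l := by positivity
        rw [Real.exp_neg]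
        refine inv_le_of_inv_le₀ hp ?_
        refine le_trans ?_ (Real.add_one_le_exp _)
        rw [inv_le_iff_one_le_mul₀ hp]
        have h2 : (1 - q ^ (l + 1)) ≥ 1 - q := by linarith
        have h3 : q ^ (l + 1) ≤ (1 - q)⁻¹ * q ^ l * (1 - q ^ (l + 1)) := by
          calc q ^ (l + 1) ≤ q ^ l := hx'
            _ = (1 - q)⁻¹ * q ^ l * (1 - q) := by field_simp
            _ ≤ _ := by gcongr
        nlinarith

/-- The Newton basis in the variable `4 x ^ 2` with nodes `-ν i`. -/
def newtonPoly (ν : ℕ → ℝ) (m : ℕ) (x : ℂ) : ℂ := ∏ i ∈ Finset.range m, (4 * x ^ 2 + (ν i : ℂ))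

lemma newtonPoly_succ (ν : ℕ → ℝ) (m : ℕ) (x : ℂ) :
    newtonPoly ν (m + 1) x = newtonPoly ν m x * (4 * x ^ 2 + (ν m : ℂ)) :=
  Finset.prod_range_succ _ _

/-- Newton's expansion of the Cauchy kernel. -/
lemma newton_kernel (ν : ℕ → ℝ) {x ζ : ℂ} (h : 4 * ζ ^ 2 - 4 * x ^ 2 ≠ 0) (m : ℕ)
    (hζ : ∀ j ≤ m, newtonPoly ν j ζ ≠ 0) :
    (4 * ζ ^ 2 - 4 * x ^ 2)⁻¹ =
      ∑ j ∈ Finset.range m, newtonPoly ν j x / newtonPoly ν (j + 1) ζ +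
        newtonPoly ν m x / (newtonPoly ν m ζ * (4 * ζ ^ 2 - 4 * x ^ 2)) := by
  induction m with
  | zero => simp [newtonPoly]
  | succ m ih =>
    rw [ih fun j hj => hζ j (by omega), Finset.sum_range_succ, add_assoc]
    congr 1
    have h1 := hζ m (by omega)
    have h2 := hζ (m + 1) le_rfl
    rw [newtonPoly_succ] at h2
    have h3 := right_ne_zero_of_mul h2
    rw [newtonPoly_succ, newtonPoly_succ, div_add_div _ _ h2 (mul_ne_zero h2 h),
      div_eq_div_iff (mul_ne_zero h1 h) (mul_ne_zero h2 (mul_ne_zero h2 h))]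
    ring

/-- The radii `q^{-m} / 2` of the circles of integration. -/
def rad (q : ℝ) (m : ℕ) : ℝ := (q ^ m)⁻¹ / 2

lemma rad_pos {q : ℝ} (hq0 : 0 < q) (m : ℕ) : 0 < rad q m := by unfold rad; positivity

lemma rad_mono {q : ℝ} (hq0 : 0 < q) (hq1 : q < 1) {j m : ℕ} (h : j ≤ m) : rad q j ≤ rad q m := by
  unfold rad
  have := pow_le_pow_of_le_one hq0.le hq1.le h
  gcongr

lemma four_mul_rad_sq (q : ℝ) (m : ℕ) : 4 * rad q m ^ 2 = (q ^ (2 * m))⁻¹ := by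
  unfold rad; rw [mul_comm 2 m, pow_mul, div_pow, inv_pow]; ring

lemma tendsto_inv_pow_atTop {q : ℝ} (hq0 : 0 < q) (hq1 : q < 1) :
    Tendsto (fun m : ℕ => (q ^ m)⁻¹) atTop atTop := by
  simp_rw [← inv_pow]
  exact tendsto_pow_atTop_atTop_of_one_lt ((one_lt_inv₀ hq0).mpr hq1)

lemma norm_newtonPoly_le {q : ℝ} (hq0 : 0 < q) (hq1 : q < 1) {ν : ℕ → ℝ} (hν0 : ∀ i, 0 ≤ ν i)
    (hν : ∀ i, ν i ≤ (q ^ (2 * i + 1))⁻¹) (m : ℕ) (x : ℂ) :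
    ‖newtonPoly ν m x‖ ≤ (q ^ (m ^ 2))⁻¹ * Real.exp (4 * ‖x‖ ^ 2 * (1 - q)⁻¹) := by
  have h1 : ‖newtonPoly ν m x‖ ≤
      (q ^ (m ^ 2))⁻¹ * ∏ i ∈ Finset.range m, (1 + 4 * ‖x‖ ^ 2 * q ^ i) := by
    induction m with
    | zero => simp [newtonPoly]
    | succ m ih =>
      have hx : ‖4 * x ^ 2 + (ν m : ℂ)‖ ≤ (q ^ (2 * m + 1))⁻¹ * (1 + 4 * ‖x‖ ^ 2 * q ^ m) := by
        have e : (q ^ (2 * m + 1))⁻¹ * (4 * ‖x‖ ^ 2 * q ^ m) = 4 * ‖x‖ ^ 2 * (q ^ (m + 1))⁻¹ := by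
          rw [show 2 * m + 1 = (m + 1) + m by ring, pow_add]
          field_simp
        have e1 : 1 ≤ (q ^ (m + 1))⁻¹ :=
          (one_le_inv₀ (by positivity)).mpr (pow_le_one₀ hq0.le hq1.le)
        calc ‖4 * x ^ 2 + (ν m : ℂ)‖ ≤ ‖4 * x ^ 2‖ + ‖(ν m : ℂ)‖ := norm_add_le _ _
          _ = 4 * ‖x‖ ^ 2 + ν m := by
            rw [Complex.norm_real, Real.norm_of_nonneg (hν0 m)]; simp
          _ ≤ 4 * ‖x‖ ^ 2 * (q ^ (m + 1))⁻¹ + (q ^ (2 * m + 1))⁻¹ :=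
            add_le_add (le_mul_of_one_le_right (by positivity) e1) (hν m)
          _ = _ := by rw [mul_add, mul_one, e]; ring
      rw [newtonPoly_succ, norm_mul, Finset.prod_range_succ]
      calc _ ≤ ((q ^ (m ^ 2))⁻¹ * ∏ i ∈ Finset.range m, (1 + 4 * ‖x‖ ^ 2 * q ^ i)) *
            ((q ^ (2 * m + 1))⁻¹ * (1 + 4 * ‖x‖ ^ 2 * q ^ m)) := by gcongr
        _ = _ := by
          rw [show (m + 1) ^ 2 = m ^ 2 + (2 * m + 1) by ring, pow_add, mul_inv]; ring
  refine h1.trans ?_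
  gcongr
  exact prod_one_add_le hq0 hq1 (by positivity) m

lemma le_norm_newtonPoly {q : ℝ} (hq0 : 0 < q) (hq1 : q < 1) {ν : ℕ → ℝ} (hν0 : ∀ i, 0 ≤ ν i)
    (hν : ∀ i, ν i ≤ (q ^ (2 * i + 1))⁻¹) (m : ℕ) {ζ : ℂ} (hζ : rad q m ≤ ‖ζ‖) :
    (4 * ‖ζ‖ ^ 2) ^ m * ∏ l ∈ Finset.range m, (1 - q ^ (l + 1)) ≤ ‖newtonPoly ν m ζ‖ := by
  rw [newtonPoly, norm_prod, ← Finset.prod_range_reflect (fun l => 1 - q ^ (l + 1)) m,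
    ← Finset.card_range m, ← Finset.prod_const, Finset.card_range, ← Finset.prod_mul_distrib]
  refine Finset.prod_le_prod (fun i hi => ?_) (fun i hi => ?_)
  · have : q ^ (m - 1 - i + 1) ≤ 1 := pow_le_one₀ hq0.le hq1.le
    have : 0 ≤ 1 - q ^ (m - 1 - i + 1) := by linarith
    positivity
  · have hi' := Finset.mem_range.mp hi
    obtain ⟨d, rfl⟩ : ∃ d, m = i + d + 1 := ⟨m - i - 1, by omega⟩
    have e : i + d + 1 - 1 - i + 1 = d + 1 := by omega
    rw [e]
    have h2 : (q ^ (2 * (i + d + 1)))⁻¹ ≤ 4 * ‖ζ‖ ^ 2 := by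
      rw [← four_mul_rad_sq]
      have := rad_pos hq0 (i + d + 1)
      gcongr
    have h3 : ν i ≤ 4 * ‖ζ‖ ^ 2 * q ^ (d + 1) := by
      calc ν i ≤ (q ^ (2 * i + 1))⁻¹ := hν i
        _ = (q ^ (2 * (i + d + 1)))⁻¹ * q ^ (2 * d + 1) := by
          rw [show 2 * (i + d + 1) = (2 * i + 1) + (2 * d + 1) by ring,
            pow_add q (2 * i + 1), mul_inv, inv_mul_cancel_right₀ (by positivity)]
        _ ≤ 4 * ‖ζ‖ ^ 2 * q ^ (d + 1) := by
          have := pow_le_pow_of_le_one hq0.le hq1.le (show d + 1 ≤ 2 * d + 1 by omega)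
          gcongr
    have h4 := norm_sub_le_norm_add (4 * ζ ^ 2) (ν i : ℂ)
    rw [Complex.norm_real, Real.norm_of_nonneg (hν0 i)] at h4
    simp only [norm_mul, norm_pow, Complex.norm_ofNat] at h4
    linarith

lemma newtonPoly_ne_zero {q : ℝ} (hq0 : 0 < q) (hq1 : q < 1) {ν : ℕ → ℝ} (hν0 : ∀ i, 0 ≤ ν i)
    (hν : ∀ i, ν i ≤ (q ^ (2 * i + 1))⁻¹) {j m : ℕ} (hj : j ≤ m) {ζ : ℂ} (hζ : rad q m ≤ ‖ζ‖) :
    newtonPoly ν j ζ ≠ 0 := by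
  have h := le_norm_newtonPoly hq0 hq1 hν0 hν j ((rad_mono hq0 hq1 hj).trans hζ)
  have h0 : 0 < ‖ζ‖ := (rad_pos hq0 m).trans_le hζ
  have h1 : 0 < ∏ l ∈ Finset.range j, (1 - q ^ (l + 1)) :=
    Finset.prod_pos fun l _ => by
      have : q ^ (l + 1) < 1 := pow_lt_one₀ hq0.le hq1 (by omega)
      linarith
  refine norm_pos_iff.mp (lt_of_lt_of_le (by positivity) h)

/-- Newton expansion of the Cauchy-type integrals `(2πi)⁻¹ ∮ φ(ζ) / (4 ζ² - 4 x²) dζ` over the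
circles of radius `q^{-m} / 2`: they differ from the partial sums of an absolutely convergent
Newton series by a null sequence. -/
lemma exists_newton_coeff {q : ℝ} (hq0 : 0 < q) (hq1 : q < 1) {ν : ℕ → ℝ} (hν0 : ∀ i, 0 ≤ ν i)
    (hν : ∀ i, ν i ≤ (q ^ (2 * i + 1))⁻¹) {φ : ℂ → ℂ} (hφ : Differentiable ℂ φ) {C r : ℝ}
    (hr0 : 0 < r) (hr1 : r < 1)
    (hC : ∀ (m : ℕ) (ζ : ℂ), ‖ζ‖ = rad q m → ‖φ ζ‖ ≤ C * r ^ m * (q ^ (m ^ 2 + m))⁻¹) :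
    ∃ c : ℕ → ℂ, ∀ x : ℂ, Summable (fun j => c j * newtonPoly ν j x) ∧
      Tendsto (fun m => (2 * Real.pi * Complex.I : ℂ)⁻¹ •
          (∮ ζ in C(0, rad q m), φ ζ * (4 * ζ ^ 2 - 4 * x ^ 2)⁻¹) -
        ∑ j ∈ Finset.range m, c j * newtonPoly ν j x) atTop (𝓝 0) := by
  obtain ⟨κ, hκ0, hκ⟩ := exists_le_prod_one_sub hq0 hq1
  have hC0 : 0 ≤ C := by
    have := (norm_nonneg _).trans (hC 0 (rad q 0 : ℂ) (by
      rw [Complex.norm_real, Real.norm_of_nonneg (rad_pos hq0 0).le]))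
    simpa using this
  have hcont : ∀ j, Continuous (newtonPoly ν j) := fun j => by
    unfold newtonPoly; fun_prop
  have hdiff : ∀ j, Differentiable ℂ (newtonPoly ν j) := fun j => by
    unfold newtonPoly; fun_prop
  -- lower bound for the denominators on the circles
  have hlow : ∀ (m : ℕ) (ζ : ℂ), ‖ζ‖ = rad q m → (q ^ (2 * m ^ 2))⁻¹ * κ ≤ ‖newtonPoly ν m ζ‖ := by
    intro m ζ hζ
    refine le_trans ?_ (le_norm_newtonPoly hq0 hq1 hν0 hν m hζ.ge)
    rw [hζ, four_mul_rad_sq, inv_pow, ← pow_mul, show 2 * m * m = 2 * m ^ 2 by ring]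
    have := hκ m
    gcongr
  have hquot : ∀ (m : ℕ) (ζ : ℂ), ‖ζ‖ = rad q m →
      ‖φ ζ / newtonPoly ν m ζ‖ ≤ C / κ * r ^ m * (q ^ (m ^ 2) * (q ^ m)⁻¹) := by
    intro m ζ hζ
    rw [norm_div]
    calc _ ≤ (C * r ^ m * (q ^ (m ^ 2 + m))⁻¹) / ((q ^ (2 * m ^ 2))⁻¹ * κ) :=
          div_le_div₀ (by positivity) (hC m ζ hζ) (by positivity) (hlow m ζ hζ)
      _ = _ := by
        rw [two_mul, pow_add, pow_add]
        field_simp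
  set c : ℕ → ℂ := fun j => (2 * Real.pi * Complex.I : ℂ)⁻¹ •
    (∮ ζ in C(0, rad q (j + 1)), φ ζ / newtonPoly ν (j + 1) ζ) with hc
  -- the coefficients do not depend on the circle
  have hcm : ∀ j m, j < m → (∮ ζ in C(0, rad q m), φ ζ / newtonPoly ν (j + 1) ζ) =
      (∮ ζ in C(0, rad q (j + 1)), φ ζ / newtonPoly ν (j + 1) ζ) := by
    intro j m hjm
    refine Complex.circleIntegral_eq_of_differentiable_on_annulus_off_countable (rad_pos hq0 _)
      (rad_mono hq0 hq1 hjm) (s := ∅) Set.countable_empty ?_ ?_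
    · refine hφ.continuous.continuousOn.div (hcont _).continuousOn fun ζ hζ => ?_
      refine newtonPoly_ne_zero hq0 hq1 hν0 hν le_rfl ?_
      simpa using hζ.2
    · intro ζ hζ
      refine (hφ ζ).div (hdiff _ ζ) (newtonPoly_ne_zero hq0 hq1 hν0 hν le_rfl ?_)
      have := hζ.1.2
      simp only [Metric.mem_closedBall, dist_zero_right, not_le] at this
      exact this.le
  refine ⟨c, fun x => ⟨?_, ?_⟩⟩
  · refine Summable.of_norm_bounded
      (g := fun j => (C / κ * r * q⁻¹ * Real.exp (4 * ‖x‖ ^ 2 * (1 - q)⁻¹)) * r ^ j)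
      ((summable_geometric_of_lt_one hr0.le hr1).mul_left _) fun j => ?_
    have h1 : ‖c j‖ ≤ rad q (j + 1) *
        (C / κ * r ^ (j + 1) * (q ^ ((j + 1) ^ 2) * (q ^ (j + 1))⁻¹)) :=
      circleIntegral.norm_two_pi_i_inv_smul_integral_le_of_norm_le_const (rad_pos hq0 _).le
        fun ζ hζ => hquot _ ζ (by simpa using hζ)
    rw [norm_mul]
    calc _ ≤ (rad q (j + 1) * (C / κ * r ^ (j + 1) * (q ^ ((j + 1) ^ 2) * (q ^ (j + 1))⁻¹))) *
          ((q ^ (j ^ 2))⁻¹ * Real.exp (4 * ‖x‖ ^ 2 * (1 - q)⁻¹)) := by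
          have := norm_newtonPoly_le hq0 hq1 hν0 hν j x
          have := rad_pos hq0 (j + 1)
          gcongr
      _ = ((C / κ * r * q⁻¹ * Real.exp (4 * ‖x‖ ^ 2 * (1 - q)⁻¹)) * r ^ j) / 2 := by
          rw [show (j + 1) ^ 2 = j ^ 2 + j + j + 1 by ring, rad]
          simp only [pow_add, pow_one]
          field_simp
      _ ≤ _ := half_le_self (by positivity)
  · have hbig : ∀ᶠ m : ℕ in atTop, 8 * ‖x‖ ^ 2 + 1 ≤ (q ^ (2 * m))⁻¹ :=
      ((tendsto_inv_pow_atTop hq0 hq1).comp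
        (tendsto_id.const_mul_atTop' (by norm_num : 0 < 2))).eventually_ge_atTop _
    have hlim : Tendsto (fun m : ℕ => (C / κ * Real.exp (4 * ‖x‖ ^ 2 * (1 - q)⁻¹)) * r ^ m)
        atTop (𝓝 0) := by
      simpa using (tendsto_pow_atTop_nhds_zero_of_lt_one hr0.le hr1).const_mul
        (C / κ * Real.exp (4 * ‖x‖ ^ 2 * (1 - q)⁻¹))
    refine squeeze_zero_norm' ?_ hlim
    filter_upwards [hbig] with m hm
    have hsep : ∀ ζ : ℂ, ‖ζ‖ = rad q m → (q ^ (2 * m))⁻¹ / 2 ≤ ‖4 * ζ ^ 2 - 4 * x ^ 2‖ := by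
      intro ζ hζ
      have h4 := norm_sub_norm_le (4 * ζ ^ 2) (4 * x ^ 2)
      simp only [norm_mul, norm_pow, Complex.norm_ofNat] at h4
      rw [hζ, four_mul_rad_sq] at h4
      linarith
    have hsep0 : ∀ ζ : ℂ, ‖ζ‖ = rad q m → 4 * ζ ^ 2 - 4 * x ^ 2 ≠ 0 := fun ζ hζ =>
      norm_pos_iff.mp (lt_of_lt_of_le (by positivity) (hsep ζ hζ))
    have hint : (∮ ζ in C(0, rad q m), φ ζ * (4 * ζ ^ 2 - 4 * x ^ 2)⁻¹) =
        ∑ j ∈ Finset.range m, newtonPoly ν j x *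
            (∮ ζ in C(0, rad q (j + 1)), φ ζ / newtonPoly ν (j + 1) ζ) +
          ∮ ζ in C(0, rad q m), newtonPoly ν m x *
            (φ ζ / newtonPoly ν m ζ * (4 * ζ ^ 2 - 4 * x ^ 2)⁻¹) := by
      have h1 : ∀ j ∈ Finset.range m, CircleIntegrable
          (fun ζ => newtonPoly ν j x * (φ ζ / newtonPoly ν (j + 1) ζ)) 0 (rad q m) := by
        intro j hj
        refine ContinuousOn.circleIntegrable (rad_pos hq0 m).le ?_
        refine continuousOn_const.mul (hφ.continuous.continuousOn.div (hcont _).continuousOn ?_)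
        intro ζ hζ
        exact newtonPoly_ne_zero hq0 hq1 hν0 hν (Finset.mem_range.mp hj) (by simpa using hζ.ge)
      have h2 : CircleIntegrable (fun ζ => newtonPoly ν m x *
            (φ ζ / newtonPoly ν m ζ * (4 * ζ ^ 2 - 4 * x ^ 2)⁻¹)) 0 (rad q m) := by
        refine ContinuousOn.circleIntegrable (rad_pos hq0 m).le ?_
        refine continuousOn_const.mul ((hφ.continuous.continuousOn.div
          (hcont _).continuousOn ?_).mul (ContinuousOn.inv₀ (by fun_prop) ?_))
        · intro ζ hζ
          exact newtonPoly_ne_zero hq0 hq1 hν0 hν le_rfl (by simpa using hζ.ge)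
        · intro ζ hζ
          exact hsep0 ζ (by simpa using hζ)
      rw [Finset.sum_congr rfl fun j hj => by
        rw [← hcm j m (Finset.mem_range.mp hj), ← circleIntegral.integral_const_mul],
        ← circleIntegral.integral_fun_sum h1, ← circleIntegral.integral_add
          (CircleIntegrable.fun_sum _ h1) h2]
      refine circleIntegral.integral_congr (rad_pos hq0 m).le fun ζ hζ => ?_
      have hζ' : ‖ζ‖ = rad q m := by simpa using hζ
      conv_lhs => rw [newton_kernel ν (hsep0 ζ hζ') m fun j hj =>
        newtonPoly_ne_zero hq0 hq1 hν0 hν hj hζ'.ge, mul_add, Finset.mul_sum]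
      congr 1
      · exact Finset.sum_congr rfl fun j _ => by ring
      · rw [div_mul_eq_div_div, div_eq_mul_inv _ (4 * ζ ^ 2 - 4 * x ^ 2)]; ring
    have hrem : (2 * Real.pi * Complex.I : ℂ)⁻¹ •
          (∮ ζ in C(0, rad q m), φ ζ * (4 * ζ ^ 2 - 4 * x ^ 2)⁻¹) -
        ∑ j ∈ Finset.range m, c j * newtonPoly ν j x =
        (2 * Real.pi * Complex.I : ℂ)⁻¹ • ∮ ζ in C(0, rad q m), newtonPoly ν m x *
            (φ ζ / newtonPoly ν m ζ * (4 * ζ ^ 2 - 4 * x ^ 2)⁻¹) := by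
      rw [hint, smul_add, Finset.smul_sum, add_comm, add_sub_assoc, ← Finset.sum_sub_distrib]
      simp only [hc, smul_eq_mul]
      rw [Finset.sum_eq_zero (fun j _ => by ring), add_zero]
    rw [hrem]
    refine (circleIntegral.norm_two_pi_i_inv_smul_integral_le_of_norm_le_const (rad_pos hq0 _).le
      (C := (q ^ (m ^ 2))⁻¹ * Real.exp (4 * ‖x‖ ^ 2 * (1 - q)⁻¹) *
        (C / κ * r ^ m * (q ^ (m ^ 2) * (q ^ m)⁻¹) * ((q ^ (2 * m))⁻¹ / 2)⁻¹))
      fun ζ hζ => ?_).trans_eq ?_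
    · have hζ' : ‖ζ‖ = rad q m := by simpa using hζ
      rw [norm_mul, norm_mul, norm_inv]
      have := norm_newtonPoly_le hq0 hq1 hν0 hν m x
      have h5 := hquot m ζ hζ'
      have h6 := hsep ζ hζ'
      gcongr
    · rw [rad, two_mul m, pow_add]
      field_simp

/-! ### The `q`-Taylor expansion -/

/-- Growth on the circles `|ζ| = q^{-m} / 2` under which the `q`-Taylor series at `0` converges. -/
def HasTaylorGrowth (q : ℝ) (f : ℂ → ℂ) : Prop :=
  Differentiable ℂ f ∧ ∃ C r : ℝ, 0 < r ∧ r < 1 ∧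
    ∀ (m : ℕ) (ζ : ℂ), ‖ζ‖ = rad q m → ‖f ζ‖ ≤ C * r ^ m * (q ^ (m ^ 2))⁻¹

/-- The squares `(q^{n/2} - q^{-n/2}) ^ 2`; `rho q n` has its zeros at `4 x ^ 2 = -rhoNode q k` with
`k < n` of the same parity as `n`, and for odd `n` also at `x = 0`. -/
def rhoNode (q : ℝ) (n : ℕ) : ℝ := ((q ^ (1 / 2 : ℝ)) ^ n - ((q ^ (1 / 2 : ℝ)) ^ n)⁻¹) ^ 2

lemma rhoNode_nonneg (q : ℝ) (n : ℕ) : 0 ≤ rhoNode q n := sq_nonneg _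

lemma rhoNode_le {q : ℝ} (hq0 : 0 < q) (hq1 : q < 1) (n : ℕ) : rhoNode q n ≤ (q ^ n)⁻¹ := by
  have hs : 0 < q ^ (1 / 2 : ℝ) := Real.rpow_pos_of_pos hq0 _
  have h2 : (q ^ (1 / 2 : ℝ)) ^ 2 = q := by
    rw [← Real.sqrt_eq_rpow, Real.sq_sqrt hq0.le]
  have e : (q ^ n)⁻¹ = (((q ^ (1 / 2 : ℝ)) ^ n)⁻¹) ^ 2 := by
    conv_lhs => rw [← h2]
    rw [← pow_mul, mul_comm, pow_mul, inv_pow]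
  have hy : 0 < (q ^ (1 / 2 : ℝ)) ^ n := by positivity
  have hy1 : (q ^ (1 / 2 : ℝ)) ^ n ≤ 1 := pow_le_one₀ hs.le (rpow_half_lt_one hq0 hq1).le
  rw [e, rhoNode]
  generalize (q ^ (1 / 2 : ℝ)) ^ n = y at *
  have : 1 ≤ y⁻¹ := (one_le_inv₀ hy).mpr hy1
  nlinarith

lemma rho_two_mul {q : ℝ} (hq0 : 0 < q) (m : ℕ) (x : ℂ) :
    rho q (2 * m) x = newtonPoly (fun i => rhoNode q (2 * i)) m x := by
  induction m with
  | zero => simp [rho, newtonPoly]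
  | succ m ih =>
    rw [mul_add, mul_one, rho_add_two hq0, ih, newtonPoly_succ, rhoNode, rootC]
    push_cast
    rfl

lemma rho_two_mul_add_one {q : ℝ} (hq0 : 0 < q) (m : ℕ) (x : ℂ) :
    rho q (2 * m + 1) x = 2 * x * newtonPoly (fun i => rhoNode q (2 * i + 1)) m x := by
  induction m with
  | zero => simp [rho_one, newtonPoly]
  | succ m ih =>
    rw [show 2 * (m + 1) + 1 = 2 * m + 1 + 2 by ring, rho_add_two hq0, ih, newtonPoly_succ,
      rhoNode, rootC]
    push_cast
    ring

lemma rhoNode_even_le {q : ℝ} (hq0 : 0 < q) (hq1 : q < 1) (i : ℕ) :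
    rhoNode q (2 * i) ≤ (q ^ (2 * i + 1))⁻¹ := by
  refine (rhoNode_le hq0 hq1 _).trans ?_
  have := pow_le_pow_of_le_one hq0.le hq1.le (show 2 * i ≤ 2 * i + 1 by omega)
  gcongr

lemma exists_hasSum_rho {q : ℝ} (hq0 : 0 < q) (hq1 : q < 1) {f : ℂ → ℂ}
    (hf : HasTaylorGrowth q f) :
    ∃ c : ℕ → ℂ, ∀ x, HasSum (fun n => c n * rho q n x) (f x) := by
  obtain ⟨hd, C, r, hr0, hr1, hC⟩ := hf
  have hC0 : 0 ≤ C := by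
    have := (norm_nonneg _).trans (hC 0 (rad q 0 : ℂ) (by
      rw [Complex.norm_real, Real.norm_of_nonneg (rad_pos hq0 0).le]))
    simpa using this
  obtain ⟨a, ha⟩ := exists_newton_coeff hq0 hq1 (ν := fun i => rhoNode q (2 * i))
    (fun i => rhoNode_nonneg q _) (rhoNode_even_le hq0 hq1) (φ := fun ζ => 4 * ζ * f ζ)
    (by fun_prop) (C := 2 * C) hr0 hr1 (fun m ζ hζ => by
      have h := hC m ζ hζ
      rw [norm_mul, norm_mul, hζ, pow_add, mul_inv, rad]
      have : (0 : ℝ) ≤ (q ^ m)⁻¹ := by positivity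
      have h' := mul_le_mul_of_nonneg_left h this
      simp only [Complex.norm_ofNat]
      linarith)
  obtain ⟨b, hb⟩ := exists_newton_coeff hq0 hq1 (ν := fun i => rhoNode q (2 * i + 1))
    (fun i => rhoNode_nonneg q _) (fun i => rhoNode_le hq0 hq1 _) (φ := fun ζ => 2 * f ζ)
    (by fun_prop) (C := 2 * C) hr0 hr1 (fun m ζ hζ => by
      have h := hC m ζ hζ
      have h1 : (q ^ (m ^ 2))⁻¹ ≤ (q ^ (m ^ 2 + m))⁻¹ := by
        have := pow_le_pow_of_le_one hq0.le hq1.le (show m ^ 2 ≤ m ^ 2 + m by omega)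
        gcongr
      have h2 := mul_le_mul_of_nonneg_left h1 (show 0 ≤ C * r ^ m by positivity)
      rw [norm_mul]
      simp only [Complex.norm_ofNat]
      linarith)
  refine ⟨fun n => if Even n then a (n / 2) else b (n / 2), fun x => ?_⟩
  obtain ⟨hsa, hta⟩ := ha x
  obtain ⟨hsb, htb⟩ := hb x
  have hx : ∀ᶠ m in atTop, ‖x‖ < rad q m := by
    have : Tendsto (rad q) atTop atTop :=
      (tendsto_inv_pow_atTop hq0 hq1).atTop_div_const two_pos
    exact this.eventually_gt_atTop _
  -- the two kernels add up to the Cauchy kernel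
  have hcauchy : ∀ᶠ m in atTop, (2 * Real.pi * Complex.I : ℂ)⁻¹ •
      (∮ ζ in C(0, rad q m), 4 * ζ * f ζ * (4 * ζ ^ 2 - 4 * x ^ 2)⁻¹) +
      2 * x * ((2 * Real.pi * Complex.I : ℂ)⁻¹ •
      (∮ ζ in C(0, rad q m), 2 * f ζ * (4 * ζ ^ 2 - 4 * x ^ 2)⁻¹)) = f x := by
    filter_upwards [hx] with m hm
    have hne : ∀ ζ ∈ Metric.sphere (0 : ℂ) (rad q m), 4 * ζ ^ 2 - 4 * x ^ 2 ≠ 0 := by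
      intro ζ hζ h0
      have h1 : ζ ^ 2 = x ^ 2 := by linear_combination h0 / 4
      have h2 : ‖ζ‖ = ‖x‖ := by
        rcases sq_eq_sq_iff_eq_or_eq_neg.mp h1 with h | h <;> simp [h]
      have h3 : ‖ζ‖ = rad q m := by simpa using hζ
      linarith
    have hci : ContinuousOn (fun ζ : ℂ => (4 * ζ ^ 2 - 4 * x ^ 2)⁻¹)
        (Metric.sphere (0 : ℂ) (rad q m)) := ContinuousOn.inv₀ (by fun_prop) hne
    have hfc : Continuous f := hd.continuous
    have i1 : CircleIntegrable (fun ζ => 4 * ζ * f ζ * (4 * ζ ^ 2 - 4 * x ^ 2)⁻¹) 0 (rad q m) :=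
      ContinuousOn.circleIntegrable (rad_pos hq0 m).le
        ((show Continuous fun ζ : ℂ => 4 * ζ * f ζ by fun_prop).continuousOn.mul hci)
    have i2 : CircleIntegrable (fun ζ => 2 * x * (2 * f ζ * (4 * ζ ^ 2 - 4 * x ^ 2)⁻¹)) 0
        (rad q m) :=
      ContinuousOn.circleIntegrable (rad_pos hq0 m).le (continuousOn_const.mul
        ((show Continuous fun ζ : ℂ => 2 * f ζ by fun_prop).continuousOn.mul hci))
    rw [mul_smul_comm, ← circleIntegral.integral_const_mul, ← smul_add,
      ← circleIntegral.integral_add i1 i2,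
      ← DiffContOnCl.two_pi_i_inv_smul_circleIntegral_sub_inv_smul (R := rad q m) (c := 0) (w := x)
        hd.diffContOnCl (by simpa using hm)]
    congr 1
    refine circleIntegral.integral_congr (rad_pos hq0 m).le fun ζ hζ => ?_
    have h0 := hne ζ hζ
    have e : 4 * ζ ^ 2 - 4 * x ^ 2 = 4 * (ζ - x) * (ζ + x) := by ring
    rw [e] at h0
    have h1 : ζ - x ≠ 0 := right_ne_zero_of_mul (left_ne_zero_of_mul h0)
    have h2 : ζ + x ≠ 0 := right_ne_zero_of_mul h0
    simp only [smul_eq_mul]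
    rw [e]
    field_simp
    ring
  have hlim : Tendsto (fun m => f x - (∑ j ∈ Finset.range m, a j *
      newtonPoly (fun i => rhoNode q (2 * i)) j x + 2 * x * ∑ j ∈ Finset.range m, b j *
      newtonPoly (fun i => rhoNode q (2 * i + 1)) j x)) atTop (𝓝 0) := by
    have := hta.add (htb.const_mul (2 * x))
    rw [mul_zero, add_zero] at this
    refine this.congr' ?_
    filter_upwards [hcauchy] with m hm
    rw [← hm]; ring
  have hval := tendsto_nhds_unique hlim (tendsto_const_nhds.sub
    (hsa.hasSum.tendsto_sum_nat.add (hsb.hasSum.tendsto_sum_nat.const_mul (2 * x))))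
  rw [eq_comm, sub_eq_zero] at hval
  rw [hval]
  refine HasSum.even_add_odd ?_ ?_
  · refine hsa.hasSum.congr_fun fun k => ?_
    simp [rho_two_mul hq0]
  · refine (hsb.hasSum.mul_left (2 * x)).congr_fun fun k => ?_
    beta_reduce
    rw [if_neg (by simp), rho_two_mul_add_one hq0, show (2 * k + 1) / 2 = k by omega]
    ring

lemma appellCoeff_ne_zero {q : ℝ} (hq0 : 0 < q) (hq1 : q < 1) (n : ℕ) : appellCoeff q n ≠ 0 :=
  div_ne_zero (Complex.ofReal_ne_zero.mpr (Real.rpow_pos_of_pos hq0 _).ne')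
    (qPoch_self_ne_zero hq0 hq1 n)

/-- The `q`-Taylor theorem. The coefficients come from applying the powers of the Askey–Wilson
operator to the expansion term by term and evaluating at the common zero `0` of the basis. -/
theorem hasSum_rhoAppell {q : ℝ} (hq0 : 0 < q) (hq1 : q < 1) {f : ℂ → ℂ}
    (hf : HasTaylorGrowth q f) (x : ℂ) :
    HasSum (fun n => (askeyWilson q)^[n] f 0 / (gam q : ℂ) ^ n * rhoAppell q n x) (f x) := by
  obtain ⟨c, hc⟩ := exists_hasSum_rho hq0 hq1 hf
  have hc' : ∀ y, HasSum (fun n => c n / appellCoeff q n * rhoAppell q n y) (f y) := fun y => by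
    convert hc y using 2 with n
    rw [rhoAppell, ← mul_assoc, div_mul_cancel₀ _ (appellCoeff_ne_zero hq0 hq1 n)]
  have hg := gam_ne_zero hq0 hq1
  have key : ∀ k, (askeyWilson q)^[k] f 0 = c k / appellCoeff q k * (gam q : ℂ) ^ k := by
    intro k
    have h1 := hasSum_askeyWilson_iterate hq0 k
      (F := fun n y => c n / appellCoeff q n * rhoAppell q n y) (fun y _ => hc' y)
      (isGeneric_zero q)
    refine h1.unique ?_
    convert hasSum_single k ?_ using 1
    · rw [askeyWilson_iterate_const_mul hq0 _ _ _ (isGeneric_zero q),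
        (isAppell_rhoAppell hq0 hq1).iterate hq0 _ _ (isGeneric_zero q)]
      simp [rhoAppell_zero]
    · intro n hn
      rw [askeyWilson_iterate_const_mul hq0 _ _ _ (isGeneric_zero q),
        (isAppell_rhoAppell hq0 hq1).iterate hq0 _ _ (isGeneric_zero q)]
      split_ifs with h
      · obtain ⟨d, rfl⟩ : ∃ d, n = k + (d + 1) := ⟨n - k - 1, by omega⟩
        rw [Nat.add_sub_cancel_left, rhoAppell_succ_at_zero hq0]
        simp
      · simp
  convert hc' x using 2 with n
  rw [key, mul_div_cancel_right₀ _ (pow_ne_zero n hg)]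

lemma taylorCoeff_mul_rho {q : ℝ} (hq0 : 0 < q) (f : ℂ → ℂ) (k : ℕ) (x : ℂ) :
    taylorCoeff q f k * rho q k x =
      (askeyWilson q)^[k] f 0 / (gam q : ℂ) ^ k * rhoAppell q k x := by
  have h : q ^ ((k : ℝ) ^ 2 / 4) = q ^ (((k : ℝ) ^ 2 - k) / 4) * (q ^ (1 / 4 : ℝ)) ^ k := by
    rw [← Real.rpow_natCast (q ^ (1 / 4 : ℝ)), ← Real.rpow_mul hq0.le, ← Real.rpow_add hq0]
    congr 1; ring
  have hne : ((q ^ (1 / 4 : ℝ) : ℝ) : ℂ) ≠ 0 :=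
    Complex.ofReal_ne_zero.mpr (Real.rpow_pos_of_pos hq0 _).ne'
  rw [taylorCoeff, rhoAppell, appellCoeff, gam, h]
  push_cast
  rw [div_pow, mul_pow]
  field_simp

lemma inv_pow_eq_exp {q : ℝ} (hq0 : 0 < q) (n : ℕ) :
    (q ^ n)⁻¹ = Real.exp (Real.log q⁻¹ * n) := by
  rw [mul_comm, Real.exp_nat_mul, Real.exp_log (inv_pos.mpr hq0), inv_pow]

lemma log_inv_pos {q : ℝ} (hq0 : 0 < q) (hq1 : q < 1) : 0 < Real.log q⁻¹ :=
  Real.log_pos ((one_lt_inv₀ hq0).mpr hq1)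

lemma log_rad {q : ℝ} (hq0 : 0 < q) (m : ℕ) :
    Real.log (rad q m) = m * Real.log q⁻¹ - Real.log 2 := by
  rw [rad, Real.log_div (by positivity) two_ne_zero, ← inv_pow, Real.log_pow]

/-- Strictly subcritical quadratic growth of `log ‖f‖` in `m` suffices. -/
lemma hasTaylorGrowth_of_exp {q : ℝ} (hq0 : 0 < q) {f : ℂ → ℂ} (hf : Differentiable ℂ f)
    {c₀ c₁ c₂ : ℝ} (h₂ : c₂ < Real.log q⁻¹)
    (h : ∀ (m : ℕ) (ζ : ℂ), ‖ζ‖ = rad q m → ‖f ζ‖ ≤ Real.exp (c₀ + c₁ * m + c₂ * m ^ 2)) :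
    HasTaylorGrowth q f := by
  set ε := Real.log q⁻¹ - c₂ with hε
  have hε0 : 0 < ε := sub_pos.mpr h₂
  refine ⟨hf, Real.exp (c₀ + (c₁ + 1) ^ 2 / (4 * ε)), Real.exp (-1), Real.exp_pos _,
    by rw [Real.exp_lt_one_iff]; norm_num, fun m ζ hζ => (h m ζ hζ).trans ?_⟩
  rw [inv_pow_eq_exp hq0, ← Real.exp_nat_mul, ← Real.exp_add, ← Real.exp_add, Real.exp_le_exp]
  -- completing the square absorbs the linear term into the slack `ε m ^ 2`
  have key : 0 ≤ ε * (m - (c₁ + 1) / (2 * ε)) ^ 2 := by positivity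
  have e : ε * (m - (c₁ + 1) / (2 * ε)) ^ 2 =
      ε * m ^ 2 - (c₁ + 1) * m + (c₁ + 1) ^ 2 / (4 * ε) := by
    field_simp
    ring
  rw [e, hε] at key
  push_cast
  linarith

lemma hasTaylorGrowth_of_polynomial {q : ℝ} (hq0 : 0 < q) (hq1 : q < 1) {f : ℂ → ℂ}
    (hf : Differentiable ℂ f) {M : ℝ} (n : ℕ) (h : ∀ x, ‖f x‖ ≤ M * (1 + ‖x‖) ^ n) :
    HasTaylorGrowth q f := by
  refine hasTaylorGrowth_of_exp hq0 hf (c₀ := Real.log (|M| + 1) + n * Real.log 2)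
    (c₁ := n * Real.log q⁻¹) (c₂ := 0) (log_inv_pos hq0 hq1) fun m ζ hζ => (h ζ).trans ?_
  have hM : 0 < |M| + 1 := by positivity
  have e : Real.exp (Real.log (|M| + 1) + n * Real.log 2 + n * Real.log q⁻¹ * m + 0 * m ^ 2) =
      (|M| + 1) * (2 * (q ^ m)⁻¹) ^ n := by
    rw [zero_mul, add_zero, Real.exp_add, Real.exp_add, Real.exp_log hM, Real.exp_nat_mul,
      Real.exp_log two_pos, mul_assoc (n : ℝ), Real.exp_nat_mul, ← inv_pow_eq_exp hq0, mul_pow,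
      mul_assoc]
  rw [e, hζ]
  have h1 : 1 ≤ (q ^ m)⁻¹ := (one_le_inv₀ (by positivity)).mpr (pow_le_one₀ hq0.le hq1.le)
  have h2 : 1 + rad q m ≤ 2 * (q ^ m)⁻¹ := by unfold rad; linarith
  have h3 : M ≤ |M| + 1 := by linarith [le_abs_self M]
  have h4 := rad_pos hq0 m
  gcongr

lemma IsQExpGrowth.norm_le_exp {q : ℝ} (hq0 : 0 < q) {f : ℂ → ℂ} {k α : ℝ}
    (h : IsQExpGrowth q f k α) : ∃ c : ℝ, ∀ (m : ℕ) (ζ : ℂ), ‖ζ‖ = rad q m →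
      ‖f ζ‖ ≤ Real.exp (c + α * (m * Real.log q⁻¹ - Real.log 2) +
        k * (m * Real.log q⁻¹ - Real.log 2) ^ 2 / (2 * Real.log q⁻¹ ^ 2)) := by
  obtain ⟨-, K, hK, h⟩ := h
  refine ⟨Real.log K, fun m ζ hζ => ?_⟩
  have hr := rad_pos hq0 m
  have h0 : ζ ≠ 0 := norm_pos_iff.mp (hζ ▸ hr)
  refine (h ζ h0).le.trans_eq ?_
  rw [hζ, Real.exp_add, Real.exp_add, Real.exp_log hK, Real.rpow_def_of_pos hr, log_rad hq0,
    Real.log_inv, neg_sq, mul_comm α]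

lemma hasTaylorGrowth_of_isQExpGrowth {q : ℝ} (hq0 : 0 < q) (hq1 : q < 1) {f : ℂ → ℂ}
    (hf : (∃ k α : ℝ, k < 2 * Real.log q⁻¹ ∧ IsQExpGrowth q f k α) ∨
      (∃ α : ℝ, α < 2 * Real.log 2 / Real.log q⁻¹ ∧ IsQExpGrowth q f (2 * Real.log q⁻¹) α)) :
    HasTaylorGrowth q f := by
  have hL := log_inv_pos hq0 hq1
  rcases hf with ⟨k, α, hk, h⟩ | ⟨α, hα, h⟩
  · obtain ⟨c, hc⟩ := h.norm_le_exp hq0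
    refine hasTaylorGrowth_of_exp hq0 h.1
      (c₀ := c - α * Real.log 2 + k * Real.log 2 ^ 2 / (2 * Real.log q⁻¹ ^ 2))
      (c₁ := α * Real.log q⁻¹ - k * Real.log 2 / Real.log q⁻¹) (c₂ := k / 2) (by linarith)
      fun m ζ hζ => (hc m ζ hζ).trans_eq ?_
    congr 1
    generalize Real.log q⁻¹ = L at *
    field_simp
    ring
  · obtain ⟨c, hc⟩ := h.norm_le_exp hq0
    rw [lt_div_iff₀ hL] at hα
    refine ⟨h.1, Real.exp (c - α * Real.log 2 + Real.log 2 ^ 2 / Real.log q⁻¹),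
      Real.exp (α * Real.log q⁻¹ - 2 * Real.log 2), Real.exp_pos _,
      by rw [Real.exp_lt_one_iff]; linarith, fun m ζ hζ => (hc m ζ hζ).trans_eq ?_⟩
    rw [inv_pow_eq_exp hq0, ← Real.exp_nat_mul, ← Real.exp_add, ← Real.exp_add]
    congr 1
    push_cast
    generalize Real.log q⁻¹ = L at *
    field_simp
    ring

lemma hasTaylorGrowth_expPoly {q : ℝ} (hq0 : 0 < q) (hq1 : q < 1) (n : ℕ) :
    HasTaylorGrowth q (fun x => appellCoeff q n * expPoly q n x) := by
  refine hasTaylorGrowth_of_polynomial hq0 hq1 ((differentiable_expPoly q n).const_mul _)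
    (M := ‖appellCoeff q n‖ * ∏ j ∈ Finset.range n,
      (1 + ‖rootC q ^ (1 - (n : ℤ)) * rootC q ^ (2 * j)‖) ^ 2) n fun x => ?_
  rw [norm_mul, expPoly, norm_mul, norm_pow, norm_neg, Complex.norm_I, one_pow, one_mul, norm_prod,
    mul_assoc]
  refine mul_le_mul_of_nonneg_left ?_ (norm_nonneg _)
  conv_rhs => rw [← Finset.card_range n, ← Finset.prod_const, Finset.card_range,
    ← Finset.prod_mul_distrib]
  refine Finset.prod_le_prod (fun j _ => norm_nonneg _) fun j _ => ?_
  generalize rootC q ^ (1 - (n : ℤ)) * rootC q ^ (2 * j) = u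
  calc ‖1 + 2 * Complex.I * u * x - u ^ 2‖ ≤ ‖1 + 2 * Complex.I * u * x‖ + ‖u ^ 2‖ :=
        norm_sub_le _ _
    _ ≤ ‖(1 : ℂ)‖ + ‖2 * Complex.I * u * x‖ + ‖u ^ 2‖ := by gcongr; exact norm_add_le _ _
    _ = 1 + 2 * ‖u‖ * ‖x‖ + ‖u‖ ^ 2 := by simp
    _ ≤ _ := by
      have := norm_nonneg u
      have := norm_nonneg x
      have : 0 ≤ ‖u‖ ^ 2 * ‖x‖ := by positivity
      nlinarith

/-! ### Power series -/

lemma hasFPowerSeriesOnBall_of_hasSum {p : ℕ → ℂ} {F : ℂ → ℂ} {r : ℝ} (hr : 0 < r)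
    (h : ∀ w, ‖w‖ < r → HasSum (fun n => p n * w ^ n) (F w)) :
    HasFPowerSeriesOnBall F (FormalMultilinearSeries.ofScalars ℂ p) 0 (ENNReal.ofReal r) where
  r_le := by
    refine ENNReal.le_of_forall_nnreal_lt fun ρ hρ => ?_
    refine FormalMultilinearSeries.le_radius_of_summable _ ?_
    have hρ' : (ρ : ℝ) < r := by
      rwa [← ENNReal.ofReal_coe_nnreal, ENNReal.ofReal_lt_ofReal_iff hr] at hρ
    have := (h ((ρ : ℝ) : ℂ) (by simpa using hρ')).summable.norm
    simpa [FormalMultilinearSeries.ofScalars_norm] using this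
  r_pos := ENNReal.ofReal_pos.mpr hr
  hasSum := by
    intro y hy
    have hy' : ‖y‖ < r := by
      rw [Metric.eball_ofReal] at hy
      simpa using hy
    simpa [FormalMultilinearSeries.ofScalars_apply_eq, mul_comm] using h y hy'

lemma coeff_eq_iteratedDeriv {p : ℕ → ℂ} {F : ℂ → ℂ} {r : ℝ} (hr : 0 < r)
    (h : ∀ w, ‖w‖ < r → HasSum (fun n => p n * w ^ n) (F w)) (n : ℕ) :
    iteratedDeriv n F 0 / (n.factorial : ℂ) = p n := by
  have h1 := (hasFPowerSeriesOnBall_of_hasSum hr h).hasFPowerSeriesAt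
  have h2 := h1.eq_formalMultilinearSeries h1.analyticAt.hasFPowerSeriesAt
  exact (congrFun (FormalMultilinearSeries.ofScalars_series_injective ℂ ℂ h2) n).symm

lemma differentiableOn_of_hasSum {p : ℕ → ℂ} {F : ℂ → ℂ} {r : ℝ} (hr : 0 < r)
    (h : ∀ w, ‖w‖ < r → HasSum (fun n => p n * w ^ n) (F w)) :
    DifferentiableOn ℂ F (Metric.ball 0 r) := by
  have := (hasFPowerSeriesOnBall_of_hasSum hr h).differentiableOn
  rwa [Metric.eball_ofReal] at this

lemma hasSum_cauchyProduct {a b : ℕ → ℂ} {A B : ℂ} (ha : HasSum a A) (hb : HasSum b B) :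
    HasSum (fun n => ∑ kl ∈ Finset.HasAntidiagonal.antidiagonal n, a kl.1 * b kl.2) (A * B) := by
  have ha' := ha.summable.norm
  have hb' := hb.summable.norm
  rw [← ha.tsum_eq, ← hb.tsum_eq,
    tsum_mul_tsum_eq_tsum_sum_antidiagonal_of_summable_norm ha' hb']
  exact (summable_norm_sum_mul_antidiagonal_of_summable_norm ha' hb').of_norm.hasSum

lemma hasSum_mul_powerSeries {a b : ℕ → ℂ} {A B w : ℂ} (ha : HasSum (fun n => a n * w ^ n) A)
    (hb : HasSum (fun n => b n * w ^ n) B) :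
    HasSum (fun n => (∑ kl ∈ Finset.HasAntidiagonal.antidiagonal n, a kl.1 * b kl.2) * w ^ n)
      (A * B) := by
  refine (hasSum_cauchyProduct ha hb).congr_fun fun n => ?_
  rw [Finset.sum_mul]
  refine Finset.sum_congr rfl fun kl hkl => ?_
  rw [← Finset.HasAntidiagonal.mem_antidiagonal.mp hkl, pow_add]
  ring

/-! ### The `q`-binomial theorem -/

lemma tendsto_qPochInf (a : ℂ) {Q : ℝ} (hQ0 : 0 < Q) (hQ1 : Q < 1) :
    Tendsto (qPoch a (Q : ℂ)) atTop (𝓝 (qPochInf a (Q : ℂ))) := by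
  have h : Summable fun j : ℕ => ‖-(a * (Q : ℂ) ^ j)‖ := by
    simp only [norm_neg, norm_mul, norm_pow, Complex.norm_real, Real.norm_of_nonneg hQ0.le]
    exact (summable_geometric_of_lt_one hQ0.le hQ1).mul_left _
  have := (multipliable_one_add_of_summable h).hasProd.tendsto_prod_nat
  simp only [← sub_eq_add_neg] at this
  exact this

lemma norm_qPoch_le (a : ℂ) {Q : ℝ} (hQ0 : 0 < Q) (hQ1 : Q < 1) (n : ℕ) :
    ‖qPoch a (Q : ℂ) n‖ ≤ Real.exp (‖a‖ * (1 - Q)⁻¹) := by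
  refine le_trans ?_ (prod_one_add_le hQ0 hQ1 (norm_nonneg a) n)
  rw [qPoch, norm_prod]
  refine Finset.prod_le_prod (fun _ _ => norm_nonneg _) fun j _ => ?_
  refine (norm_sub_le _ _).trans_eq ?_
  rw [norm_one, norm_mul, norm_pow, Complex.norm_real, Real.norm_of_nonneg hQ0.le]

lemma exists_le_norm_qPoch_self {Q : ℝ} (hQ0 : 0 < Q) (hQ1 : Q < 1) :
    ∃ c : ℝ, 0 < c ∧ ∀ n, c ≤ ‖qPoch (Q : ℂ) (Q : ℂ) n‖ := by
  obtain ⟨c, hc0, hc⟩ := exists_le_prod_one_sub hQ0 hQ1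
  refine ⟨c, hc0, fun n => (hc n).trans_eq ?_⟩
  rw [qPoch, norm_prod]
  refine Finset.prod_congr rfl fun j _ => ?_
  have h1 : Q ^ (j + 1) ≤ 1 := pow_le_one₀ hQ0.le hQ1.le
  have e : (1 : ℂ) - Q * (Q : ℂ) ^ j = ((1 - Q ^ (j + 1) : ℝ) : ℂ) := by push_cast; ring
  rw [e, Complex.norm_real, Real.norm_of_nonneg (by linarith)]

/-- The coefficients `(a; Q)_n / (Q; Q)_n` of the `q`-binomial series. -/
def qBinomCoeff (a : ℂ) (Q : ℝ) (n : ℕ) : ℂ := qPoch a (Q : ℂ) n / qPoch (Q : ℂ) (Q : ℂ) n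

lemma qBinomCoeff_zero (a : ℂ) (Q : ℝ) : qBinomCoeff a Q 0 = 1 := by simp [qBinomCoeff, qPoch]

lemma qBinomCoeff_succ (a : ℂ) {Q : ℝ} (hQ0 : 0 < Q) (hQ1 : Q < 1) (n : ℕ) :
    qBinomCoeff a Q (n + 1) * (1 - (Q : ℂ) ^ (n + 1)) =
      qBinomCoeff a Q n * (1 - a * (Q : ℂ) ^ n) := by
  have h1 := one_sub_pow_ne_zero hQ0 hQ1 n
  have h2 := qPoch_self_ne_zero hQ0 hQ1 n
  rw [qBinomCoeff, qBinomCoeff, qPoch_succ, qPoch_self_succ]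
  field_simp

lemma summable_of_bounded_coeff {p : ℕ → ℂ} {C : ℝ} (hp : ∀ n, ‖p n‖ ≤ C) {w : ℂ} (hw : ‖w‖ < 1) :
    Summable fun n => p n * w ^ n := by
  refine Summable.of_norm_bounded (g := fun n => C * ‖w‖ ^ n)
    ((summable_geometric_of_lt_one (norm_nonneg w) hw).mul_left C) fun n => ?_
  rw [norm_mul, norm_pow]
  have := hp n
  gcongr

lemma summable_qBinom (a : ℂ) {Q : ℝ} (hQ0 : 0 < Q) (hQ1 : Q < 1) {w : ℂ} (hw : ‖w‖ < 1) :
    Summable fun n => qBinomCoeff a Q n * w ^ n := by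
  obtain ⟨c, hc0, hc⟩ := exists_le_norm_qPoch_self hQ0 hQ1
  refine summable_of_bounded_coeff (C := Real.exp (‖a‖ * (1 - Q)⁻¹) / c) (fun n => ?_) hw
  rw [qBinomCoeff, norm_div]
  exact div_le_div₀ (Real.exp_pos _).le (norm_qPoch_le a hQ0 hQ1 n) hc0 (hc n)

lemma qBinom_functional_eq (a : ℂ) {Q : ℝ} (hQ0 : 0 < Q) (hQ1 : Q < 1) {w : ℂ} (hw : ‖w‖ < 1) :
    (1 - w) * ∑' n, qBinomCoeff a Q n * w ^ n =
      (1 - a * w) * ∑' n, qBinomCoeff a Q n * ((Q : ℂ) * w) ^ n := by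
  have hw' : ‖(Q : ℂ) * w‖ < 1 := by
    rw [norm_mul, Complex.norm_real, Real.norm_of_nonneg hQ0.le]
    nlinarith [norm_nonneg w]
  have h1 := summable_qBinom a hQ0 hQ1 hw
  have h2 := summable_qBinom a hQ0 hQ1 hw'
  have e1 : ∑' n, qBinomCoeff a Q n * w ^ n - ∑' n, qBinomCoeff a Q n * ((Q : ℂ) * w) ^ n =
      w * ∑' n, qBinomCoeff a Q n * w ^ n -
        a * w * ∑' n, qBinomCoeff a Q n * ((Q : ℂ) * w) ^ n := by
    -- compare the coefficients of `w ^ (n + 1)`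
    rw [← h1.tsum_sub h2, (h1.sub h2).tsum_eq_zero_add, ← tsum_mul_left, ← tsum_mul_left,
      ← (h1.mul_left w).tsum_sub (h2.mul_left (a * w))]
    simp only [pow_zero, sub_self, zero_add]
    refine tsum_congr fun n => ?_
    have := qBinomCoeff_succ a hQ0 hQ1 n
    rw [mul_pow, mul_pow]
    linear_combination w ^ (n + 1) * this
  linear_combination e1

/-- The `q`-binomial theorem. -/
theorem qBinom (a : ℂ) {Q : ℝ} (hQ0 : 0 < Q) (hQ1 : Q < 1) {w : ℂ} (hw : ‖w‖ < 1) :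
    qPochInf w (Q : ℂ) * ∑' n, qBinomCoeff a Q n * w ^ n = qPochInf (a * w) (Q : ℂ) := by
  set G : ℂ → ℂ := fun w => ∑' n, qBinomCoeff a Q n * w ^ n with hG
  have hlt : ∀ N : ℕ, ‖(Q : ℂ) ^ N * w‖ < 1 := fun N => by
    rw [norm_mul, norm_pow, Complex.norm_real, Real.norm_of_nonneg hQ0.le]
    have := pow_le_one₀ (n := N) hQ0.le hQ1.le
    nlinarith [norm_nonneg w]
  have hiter : ∀ N, qPoch w (Q : ℂ) N * G w =
      qPoch (a * w) (Q : ℂ) N * G ((Q : ℂ) ^ N * w) := by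
    intro N
    induction N with
    | zero => simp [qPoch]
    | succ N ih =>
      have h := qBinom_functional_eq a hQ0 hQ1 (hlt N)
      rw [← mul_assoc (Q : ℂ), ← pow_succ'] at h
      rw [qPoch_succ, qPoch_succ]
      simp only [hG] at ih ⊢
      linear_combination (1 - w * (Q : ℂ) ^ N) * ih + qPoch (a * w) (Q : ℂ) N * h
  have hG0 : G 0 = 1 := by
    simp only [hG]
    rw [tsum_eq_single 0 fun n hn => by simp [hn]]
    simp [qBinomCoeff_zero]
  have hcont : ContinuousAt G 0 :=
    ((differentiableOn_of_hasSum (F := G) one_pos fun w hw =>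
      (summable_qBinom a hQ0 hQ1 hw).hasSum).continuousOn).continuousAt
        (Metric.ball_mem_nhds 0 one_pos)
  have hz : Tendsto (fun N : ℕ => (Q : ℂ) ^ N * w) atTop (𝓝 0) := by
    have : ‖(Q : ℂ)‖ < 1 := by rwa [Complex.norm_real, Real.norm_of_nonneg hQ0.le]
    simpa using (tendsto_pow_atTop_nhds_zero_of_norm_lt_one this).mul_const w
  have hlim := hcont.tendsto.comp hz
  rw [hG0] at hlim
  have h1 := (tendsto_qPochInf w hQ0 hQ1).mul_const (G w)
  have h2 := (tendsto_qPochInf (a * w) hQ0 hQ1).mul hlim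
  rw [mul_one] at h2
  exact tendsto_nhds_unique h1 (h2.congr fun N => (hiter N).symm)

/-- The case `a = 0` of the `q`-binomial theorem exhibits an inverse of `(w; Q)_∞`. -/
lemma qPochInf_ne_zero {Q : ℝ} (hQ0 : 0 < Q) (hQ1 : Q < 1) {w : ℂ} (hw : ‖w‖ < 1) :
    qPochInf w (Q : ℂ) ≠ 0 := by
  have h := qBinom 0 hQ0 hQ1 hw
  rw [zero_mul] at h
  have h1 : qPochInf 0 (Q : ℂ) = 1 := by simp [qPochInf]
  rw [h1] at h
  exact left_ne_zero_of_mul_eq_one h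

lemma qPochInf_eq_mul (a : ℂ) {Q : ℝ} (hQ0 : 0 < Q) (hQ1 : Q < 1) :
    qPochInf a (Q : ℂ) = (1 - a) * qPochInf (a * Q) (Q : ℂ) := by
  have h1 := (tendsto_add_atTop_iff_nat 1).mpr (tendsto_qPochInf a hQ0 hQ1)
  have h2 := (tendsto_qPochInf (a * Q) hQ0 hQ1).const_mul (1 - a)
  refine tendsto_nhds_unique h1 (h2.congr fun n => ?_)
  rw [qPoch, qPoch, Finset.prod_range_succ', mul_comm]
  congr 1
  · exact Finset.prod_congr rfl fun j _ => by ring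
  · simp

lemma qPochInf_sq (w : ℂ) {Q : ℝ} (hQ0 : 0 < Q) (hQ1 : Q < 1) :
    qPochInf (w ^ 2) ((Q : ℂ) ^ 2) = qPochInf w (Q : ℂ) * qPochInf (-w) (Q : ℂ) := by
  have h2 : Q ^ 2 < 1 := pow_lt_one₀ hQ0.le hQ1 two_ne_zero
  have h := tendsto_qPochInf (w ^ 2) (pow_pos hQ0 2) h2
  rw [Complex.ofReal_pow] at h
  refine tendsto_nhds_unique h
    (((tendsto_qPochInf w hQ0 hQ1).mul (tendsto_qPochInf (-w) hQ0 hQ1)).congr fun n => ?_)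
  rw [qPoch, qPoch, qPoch, ← Finset.prod_mul_distrib]
  exact Finset.prod_congr rfl fun j _ => by ring

lemma qPochInf_sq_base (w : ℂ) {s : ℝ} (hs0 : 0 < s) (hs1 : s < 1) :
    qPochInf w (s : ℂ) = qPochInf w ((s : ℂ) ^ 2) * qPochInf (s * w) ((s : ℂ) ^ 2) := by
  have h2 : s ^ 2 < 1 := pow_lt_one₀ hs0.le hs1 two_ne_zero
  have h := (tendsto_qPochInf w (pow_pos hs0 2) h2).mul
    (tendsto_qPochInf (s * w) (pow_pos hs0 2) h2)
  rw [Complex.ofReal_pow] at h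
  refine tendsto_nhds_unique ((tendsto_qPochInf w hs0 hs1).comp
    (tendsto_id.const_mul_atTop' (by norm_num : 0 < 2))) (h.congr fun n => ?_)
  simp only [Function.comp, id]
  induction n with
  | zero => simp [qPoch]
  | succ n ih =>
    rw [mul_add, mul_one, qPoch_succ, qPoch_succ, qPoch_succ, qPoch_succ, ← ih]
    ring

/-! ### The `q`-exponential function -/

/-- The Appell sequence `q^{n²/4} expPoly q n / (q; q)_n` whose generating function is the series
in the definition of `qExp`. -/
def expAppell (q : ℝ) (n : ℕ) (x : ℂ) : ℂ := appellCoeff q n * expPoly q n x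

lemma norm_appellCoeff_even_odd {q : ℝ} (hq0 : 0 < q) (hq1 : q < 1) :
    ∃ C : ℝ, 0 < C ∧ (∀ m : ℕ, ‖appellCoeff q (2 * m)‖ ≤ C * q ^ (m ^ 2)) ∧
      ∀ m : ℕ, ‖appellCoeff q (2 * m + 1)‖ ≤ C * q ^ (m ^ 2) := by
  obtain ⟨c, hc0, hc⟩ := exists_le_norm_qPoch_self hq0 hq1
  have key : ∀ (n m : ℕ), (m : ℝ) ^ 2 ≤ (n : ℝ) ^ 2 / 4 →
      ‖appellCoeff q n‖ ≤ c⁻¹ * q ^ (m ^ 2) := by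
    intro n m h
    have hp := Real.rpow_pos_of_pos hq0 ((n : ℝ) ^ 2 / 4)
    have h1 : q ^ ((n : ℝ) ^ 2 / 4) ≤ q ^ (m ^ 2) := by
      have := Real.rpow_le_rpow_of_exponent_ge hq0 hq1.le
        (show ((m ^ 2 : ℕ) : ℝ) ≤ (n : ℝ) ^ 2 / 4 by push_cast; exact h)
      rwa [Real.rpow_natCast] at this
    rw [appellCoeff, norm_div, Complex.norm_real, Real.norm_of_nonneg hp.le, mul_comm,
      ← div_eq_mul_inv]
    exact div_le_div₀ (by positivity) h1 hc0 (hc n)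
  refine ⟨c⁻¹, inv_pos.mpr hc0, fun m => key _ m ?_, fun m => key _ m ?_⟩
  · push_cast
    linarith
  · push_cast
    nlinarith [(Nat.cast_nonneg m : (0 : ℝ) ≤ m)]

lemma exists_norm_rhoAppell_le {q : ℝ} (hq0 : 0 < q) (hq1 : q < 1) (x : ℂ) :
    ∃ C : ℝ, ∀ n, ‖rhoAppell q n x‖ ≤ C := by
  obtain ⟨C, hC0, he, ho⟩ := norm_appellCoeff_even_odd hq0 hq1
  set E := Real.exp (4 * ‖x‖ ^ 2 * (1 - q)⁻¹) with hE
  have hE0 : 0 < E := Real.exp_pos _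
  refine ⟨C * E * (1 + 2 * ‖x‖), fun n => ?_⟩
  have hx := norm_nonneg x
  rcases Nat.even_or_odd' n with ⟨m, rfl | rfl⟩
  · have h := norm_newtonPoly_le hq0 hq1 (fun i => rhoNode_nonneg q (2 * i))
      (rhoNode_even_le hq0 hq1) m x
    rw [rhoAppell, rho_two_mul hq0, norm_mul]
    calc _ ≤ (C * q ^ (m ^ 2)) * ((q ^ (m ^ 2))⁻¹ * E) := by
          have := he m
          gcongr
      _ = C * E * 1 := by field_simp
      _ ≤ _ := by gcongr; linarith
  · have h := norm_newtonPoly_le hq0 hq1 (fun i => rhoNode_nonneg q (2 * i + 1))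
      (fun i => rhoNode_le hq0 hq1 _) m x
    rw [rhoAppell, rho_two_mul_add_one hq0, norm_mul, norm_mul, norm_mul, Complex.norm_ofNat]
    calc _ ≤ (C * q ^ (m ^ 2)) * (2 * ‖x‖ * ((q ^ (m ^ 2))⁻¹ * E)) := by
          have := ho m
          gcongr
      _ = C * E * (2 * ‖x‖) := by field_simp
      _ ≤ _ := by gcongr; linarith

/-- The expansion of one Appell sequence in the other is the `q`-Taylor expansion of a
polynomial. -/
lemma expAppell_eq_sum {q : ℝ} (hq0 : 0 < q) (hq1 : q < 1) (n : ℕ) (x : ℂ) :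
    expAppell q n x = ∑ kl ∈ Finset.HasAntidiagonal.antidiagonal n,
      expAppell q kl.1 0 * rhoAppell q kl.2 x := by
  have h := hasSum_rhoAppell hq0 hq1 (hasTaylorGrowth_expPoly hq0 hq1 n) x
  have hD := fun k => (isAppell_expPoly hq0 hq1).iterate hq0 k n (isGeneric_zero q)
  simp only [hD] at h
  refine h.unique ?_
  rw [← Finset.Nat.sum_antidiagonal_swap, Finset.Nat.sum_antidiagonal_eq_sum_range_succ_mk]
  have hg := gam_ne_zero hq0 hq1
  have hs : ∑ k ∈ Finset.range n.succ, expAppell q (k, n - k).swap.1 0 *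
      rhoAppell q (k, n - k).swap.2 x = ∑ k ∈ Finset.range n.succ,
      (if k ≤ n then (gam q : ℂ) ^ k * (appellCoeff q (n - k) * expPoly q (n - k) 0) else 0) /
        (gam q : ℂ) ^ k * rhoAppell q k x := by
    refine Finset.sum_congr rfl fun k hk => ?_
    rw [if_pos (Nat.lt_succ_iff.mp (Finset.mem_range.mp hk)),
      mul_div_cancel_left₀ _ (pow_ne_zero k hg)]
    rfl
  rw [hs]
  refine hasSum_sum_of_ne_finset_zero fun k hk => ?_
  rw [if_neg fun h => hk (Finset.mem_range.mpr (Nat.lt_succ_of_le h)), zero_div, zero_mul]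

lemma rpow_quarter_sq {q : ℝ} (hq0 : 0 < q) : ((q ^ (1 / 4 : ℝ) : ℝ) : ℂ) ^ 2 = rootC q := by
  rw [rootC, ← Complex.ofReal_pow, ← Real.rpow_natCast, ← Real.rpow_mul hq0.le]
  norm_num

lemma expAppell_add_two {q : ℝ} (hq0 : 0 < q) (hq1 : q < 1) (n : ℕ) (x : ℂ) :
    expAppell q (n + 2) x = expAppell q n x *
      (((1 - (q : ℂ) ^ (n + 1)) ^ 2 + 4 * (q : ℂ) ^ (n + 1) * x ^ 2) /
        ((1 - (q : ℂ) ^ (n + 1)) * (1 - (q : ℂ) ^ (n + 2)))) := by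
  have hs := rootC_ne_zero hq0
  have h1 := one_sub_pow_ne_zero hq0 hq1 n
  have h2 := one_sub_pow_ne_zero hq0 hq1 (n + 1)
  have hb : rootC q ^ (n + 1) ≠ 0 := pow_ne_zero _ hs
  have e1 : (q : ℂ) ^ (n + 1) = (rootC q ^ (n + 1)) ^ 2 := by
    rw [← rootC_sq hq0, ← pow_mul, ← pow_mul, mul_comm]
  have e2 : ((q ^ (1 / 4 : ℝ) : ℝ) : ℂ) * rootC q ^ n *
      (((q ^ (1 / 4 : ℝ) : ℝ) : ℂ) * rootC q ^ (n + 1)) = (rootC q ^ (n + 1)) ^ 2 := by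
    rw [pow_two (rootC q ^ (n + 1)), pow_succ, ← rpow_quarter_sq hq0]
    ring
  rw [expAppell, expAppell, expPoly_add_two hq0, appellCoeff_succ hq0, appellCoeff_succ hq0]
  rw [show n + 1 + 1 = n + 2 by ring] at *
  have e3 : appellCoeff q n *
      (((q ^ (1 / 4 : ℝ) : ℝ) : ℂ) * rootC q ^ n / (1 - (q : ℂ) ^ (n + 1))) *
      (((q ^ (1 / 4 : ℝ) : ℝ) : ℂ) * rootC q ^ (n + 1) / (1 - (q : ℂ) ^ (n + 2))) =
      appellCoeff q n * ((rootC q ^ (n + 1)) ^ 2 /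
        ((1 - (q : ℂ) ^ (n + 1)) * (1 - (q : ℂ) ^ (n + 2)))) := by
    rw [← e2]
    field_simp
  rw [e3, e1]
  rw [e1] at h1
  generalize rootC q ^ (n + 1) = b at *
  field_simp
  linear_combination (-(appellCoeff q n * expPoly q n x * (4 * b ^ 2 * x ^ 2))) * Complex.I_sq

lemma expAppell_zero (q : ℝ) (x : ℂ) : expAppell q 0 x = 1 := by
  simp [expAppell, appellCoeff_zero, expPoly]

lemma expAppell_one {q : ℝ} (hq0 : 0 < q) (x : ℂ) :
    expAppell q 1 x = ((q ^ (1 / 4 : ℝ) : ℝ) : ℂ) / (1 - (q : ℂ)) * (2 * x) := by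
  have h := appellCoeff_succ hq0 0
  rw [zero_add, appellCoeff_zero] at h
  rw [expAppell, expPoly_one, h]
  simp

lemma expAppell_odd_at_zero {q : ℝ} (hq0 : 0 < q) (hq1 : q < 1) (m : ℕ) :
    expAppell q (2 * m + 1) 0 = 0 := by
  induction m with
  | zero => rw [mul_zero, zero_add, expAppell_one hq0, mul_zero, mul_zero]
  | succ m ih => rw [show 2 * (m + 1) + 1 = 2 * m + 1 + 2 by ring, expAppell_add_two hq0 hq1, ih,
      zero_mul]

lemma expAppell_even_at_zero {q : ℝ} (hq0 : 0 < q) (hq1 : q < 1) (m : ℕ) :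
    expAppell q (2 * m) 0 = qBinomCoeff q (q ^ 2) m := by
  have h2 : q ^ 2 < 1 := pow_lt_one₀ hq0.le hq1 two_ne_zero
  induction m with
  | zero => rw [mul_zero, expAppell_zero, qBinomCoeff_zero]
  | succ m ih =>
    have h := qBinomCoeff_succ (q : ℂ) (pow_pos hq0 2) h2 m
    have h1 := one_sub_pow_ne_zero hq0 hq1 (2 * m)
    have h3 := one_sub_pow_ne_zero hq0 hq1 (2 * m + 1)
    rw [show 2 * (m + 1) = 2 * m + 2 by ring, expAppell_add_two hq0 hq1, ih]
    push_cast at h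
    rw [← pow_mul, ← pow_mul, ← pow_succ', show 2 * (m + 1) = 2 * m + 1 + 1 by ring] at h
    rw [mul_div_assoc', div_eq_iff (mul_ne_zero h1 h3)]
    linear_combination (-(1 - (q : ℂ) ^ (2 * m + 1))) * h

lemma hasSum_expAppell_at_zero {q : ℝ} (hq0 : 0 < q) (hq1 : q < 1) {w : ℂ} (hw : ‖w‖ < 1) :
    HasSum (fun n => expAppell q n 0 * w ^ n)
      (qPochInf ((q : ℂ) * w ^ 2) ((q : ℂ) ^ 2) / qPochInf (w ^ 2) ((q : ℂ) ^ 2)) := by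
  have h2 : q ^ 2 < 1 := pow_lt_one₀ hq0.le hq1 two_ne_zero
  have hw2 : ‖w ^ 2‖ < 1 := by
    rw [norm_pow]; exact pow_lt_one₀ (norm_nonneg w) hw two_ne_zero
  have h := qBinom (q : ℂ) (pow_pos hq0 2) h2 hw2
  have hne := qPochInf_ne_zero (pow_pos hq0 2) h2 hw2
  push_cast at h hne
  rw [← h, mul_div_cancel_left₀ _ hne]
  rw [← add_zero (∑' n, _)]
  refine HasSum.even_add_odd ?_ ?_
  · refine (summable_qBinom (q : ℂ) (pow_pos hq0 2) h2 hw2).hasSum.congr_fun fun m => ?_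
    rw [expAppell_even_at_zero hq0 hq1, pow_mul]
  · refine hasSum_zero.congr_fun fun m => ?_
    rw [expAppell_odd_at_zero hq0 hq1, zero_mul]

lemma qPochInf_sq_ne_zero {q : ℝ} (hq0 : 0 < q) (hq1 : q < 1) {w : ℂ} (hw : ‖w‖ < 1) :
    qPochInf (w ^ 2) ((q : ℂ) ^ 2) ≠ 0 ∧ qPochInf ((q : ℂ) * w ^ 2) ((q : ℂ) ^ 2) ≠ 0 := by
  have h2 : q ^ 2 < 1 := pow_lt_one₀ hq0.le hq1 two_ne_zero
  have hw2 : ‖w ^ 2‖ < 1 := by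
    rw [norm_pow]; exact pow_lt_one₀ (norm_nonneg w) hw two_ne_zero
  have hw3 : ‖(q : ℂ) * w ^ 2‖ < 1 := by
    rw [norm_mul, Complex.norm_real, Real.norm_of_nonneg hq0.le]
    nlinarith [norm_nonneg (w ^ 2)]
  have ha := qPochInf_ne_zero (pow_pos hq0 2) h2 hw2
  have hb := qPochInf_ne_zero (pow_pos hq0 2) h2 hw3
  push_cast at ha hb
  exact ⟨ha, hb⟩

/-- The `q`-exponential function is the generating function of the Appell sequence that vanishes
at `0`, as `exp (x w)` is that of `x ^ n / n!`. -/
theorem hasSum_qExp {q : ℝ} (hq0 : 0 < q) (hq1 : q < 1) (x : ℂ) {w : ℂ} (hw : ‖w‖ < 1) :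
    HasSum (fun n => rhoAppell q n x * w ^ n) (qExp q x w) := by
  obtain ⟨C, hC⟩ := exists_norm_rhoAppell_le hq0 hq1 x
  have hB := (summable_of_bounded_coeff hC hw).hasSum
  have hA := hasSum_mul_powerSeries (hasSum_expAppell_at_zero hq0 hq1 hw) hB
  simp only [← expAppell_eq_sum hq0 hq1] at hA
  obtain ⟨h1, h2⟩ := qPochInf_sq_ne_zero hq0 hq1 hw
  have : qExp q x w = ∑' n, rhoAppell q n x * w ^ n := by
    rw [qExp_eq_tsum_expPoly hq0]
    change _ * (∑' n, expAppell q n x * w ^ n) = _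
    rw [hA.tsum_eq, ← mul_assoc, div_mul_div_comm, mul_comm (qPochInf (w ^ 2) _),
      div_self (mul_ne_zero h2 h1), one_mul]
  rw [this]
  exact hB

/-! ### The value at `η` and the zeros of the `q`-cosine -/

lemma four_mul_eta_sq {q : ℝ} (hq0 : 0 < q) :
    4 * rootC q * (eta q : ℂ) ^ 2 = (1 + rootC q) ^ 2 := by
  have h0 : ((q ^ (1 / 4 : ℝ) : ℝ) : ℂ) ≠ 0 :=
    Complex.ofReal_ne_zero.mpr (Real.rpow_pos_of_pos hq0 _).ne'
  rw [eta, Real.rpow_neg hq0.le, ← rpow_quarter_sq hq0]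
  push_cast
  field_simp
  ring

lemma expAppell_eta {q : ℝ} (hq0 : 0 < q) (hq1 : q < 1) (n : ℕ) :
    expAppell q n (eta q) = qBinomCoeff (-rootC q) q n := by
  have hs := rootC_ne_zero hq0
  induction n using Nat.twoStepInduction with
  | zero => rw [expAppell_zero, qBinomCoeff_zero]
  | one =>
    have h1 := one_sub_pow_ne_zero hq0 hq1 0
    have h0 : ((q ^ (1 / 4 : ℝ) : ℝ) : ℂ) ≠ 0 :=
      Complex.ofReal_ne_zero.mpr (Real.rpow_pos_of_pos hq0 _).ne'
    rw [zero_add, pow_one] at h1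
    rw [expAppell_one hq0]
    simp only [qBinomCoeff, qPoch, Finset.prod_range_one, pow_zero, mul_one]
    rw [eta, Real.rpow_neg hq0.le, ← rpow_quarter_sq hq0]
    push_cast
    field_simp
    ring
  | more n ih _ =>
    have h1 := one_sub_pow_ne_zero hq0 hq1 n
    have h2 := one_sub_pow_ne_zero hq0 hq1 (n + 1)
    have e1 := qBinomCoeff_succ (-rootC q) hq0 hq1 n
    have e2 := qBinomCoeff_succ (-rootC q) hq0 hq1 (n + 1)
    have e3 := four_mul_eta_sq hq0
    have e4 := rootC_sq hq0
    rw [expAppell_add_two hq0 hq1, ih, mul_div_assoc', div_eq_iff (mul_ne_zero h1 h2)]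
    rw [show n + 1 + 1 = n + 2 by ring] at e2 h2
    have e5 : (1 - (q : ℂ) ^ (n + 1)) ^ 2 + 4 * (q : ℂ) ^ (n + 1) * (eta q : ℂ) ^ 2 =
        (1 - -rootC q * (q : ℂ) ^ n) * (1 - -rootC q * (q : ℂ) ^ (n + 1)) := by
      have : (q : ℂ) ^ (n + 1) = (q : ℂ) ^ n * rootC q ^ 2 := by rw [e4, pow_succ]
      rw [this]
      linear_combination (q : ℂ) ^ n * rootC q * e3
    rw [e5]
    linear_combination (-(1 - -rootC q * (q : ℂ) ^ (n + 1))) * e1 - (1 - (q : ℂ) ^ (n + 1)) * e2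

lemma qExp_eta {q : ℝ} (hq0 : 0 < q) (hq1 : q < 1) {w : ℂ} (hw : ‖w‖ < 1) :
    qExp q (eta q) w = qPochInf (-w) (rootC q) / qPochInf ((q : ℂ) * w ^ 2) ((q : ℂ) ^ 2) := by
  have hs0 : 0 < q ^ (1 / 2 : ℝ) := Real.rpow_pos_of_pos hq0 _
  have h := qBinom (-rootC q) hq0 hq1 hw
  have hb := qPochInf_sq_base (-w) hs0 (rpow_half_lt_one hq0 hq1)
  change qPochInf (-w) (rootC q) = qPochInf (-w) (rootC q ^ 2) *
    qPochInf (rootC q * -w) (rootC q ^ 2) at hb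
  rw [rootC_sq hq0] at hb
  rw [qExp_eq_tsum_expPoly hq0]
  change _ * (∑' n, expAppell q n (eta q) * w ^ n) = _
  simp only [expAppell_eta hq0 hq1]
  rw [qPochInf_sq w hq0 hq1, hb, mul_neg, ← neg_mul, ← h]
  ring

lemma norm_one_sub_le_norm_one_add {u : ℂ} (hu : 0 ≤ u.re) : ‖1 - u‖ ≤ ‖1 + u‖ := by
  rw [← sq_le_sq₀ (norm_nonneg _) (norm_nonneg _), Complex.sq_norm, Complex.sq_norm,
    Complex.normSq_apply, Complex.normSq_apply]
  simp
  nlinarith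

lemma norm_one_sub_lt_norm_one_add {u : ℂ} (hu : 0 < u.re) : ‖1 - u‖ < ‖1 + u‖ := by
  rw [← sq_lt_sq₀ (norm_nonneg _) (norm_nonneg _), Complex.sq_norm, Complex.sq_norm,
    Complex.normSq_apply, Complex.normSq_apply]
  simp
  nlinarith

lemma norm_qPochInf_le {s : ℝ} (hs0 : 0 < s) (hs1 : s < 1) {w : ℂ} (hw : 0 ≤ w.re) :
    ‖qPochInf w (s : ℂ)‖ ≤ ‖qPochInf (-w) (s : ℂ)‖ := by
  refine le_of_tendsto_of_tendsto' (tendsto_qPochInf w hs0 hs1).norm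
    (tendsto_qPochInf (-w) hs0 hs1).norm fun n => ?_
  rw [qPoch, qPoch, norm_prod, norm_prod]
  refine Finset.prod_le_prod (fun _ _ => norm_nonneg _) fun j _ => ?_
  rw [neg_mul, sub_neg_eq_add]
  refine norm_one_sub_le_norm_one_add ?_
  rw [← Complex.ofReal_pow, Complex.re_mul_ofReal]
  positivity

/-- Off the imaginary axis the two products have different moduli, factor by factor. -/
lemma norm_qPochInf_lt {s : ℝ} (hs0 : 0 < s) (hs1 : s < 1) {w : ℂ} (hw : 0 < w.re)
    (hw1 : ‖w‖ < 1) : ‖qPochInf w (s : ℂ)‖ < ‖qPochInf (-w) (s : ℂ)‖ := by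
  have hws : ‖-w * (s : ℂ)‖ < 1 := by
    rw [norm_mul, norm_neg, Complex.norm_real, Real.norm_of_nonneg hs0.le]
    nlinarith [norm_nonneg w]
  have h1 := norm_pos_iff.mpr (qPochInf_ne_zero hs0 hs1 hws)
  have h2 : ‖qPochInf (w * (s : ℂ)) (s : ℂ)‖ ≤ ‖qPochInf (-w * (s : ℂ)) (s : ℂ)‖ := by
    rw [neg_mul]
    refine norm_qPochInf_le hs0 hs1 ?_
    rw [Complex.re_mul_ofReal]
    positivity
  have h3 := norm_one_sub_lt_norm_one_add hw
  rw [qPochInf_eq_mul w hs0 hs1, qPochInf_eq_mul (-w) hs0 hs1, norm_mul, norm_mul, sub_neg_eq_add]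
  exact mul_lt_mul_of_lt_of_le_of_nonneg_of_pos h3 h2 (norm_nonneg _) h1

/-- All zeros of `C_q(η; ·)` in the unit disk are real, so there are none of modulus smaller than
the smallest positive one. -/
lemma qExp_eta_add_ne_zero {q : ℝ} (hq0 : 0 < q) (hq1 : q < 1) {w₁ : ℝ}
    (hw₁ : IsLeast {w : ℝ | 0 < w ∧ qCosEta q w = 0} w₁) {w : ℂ} (hw : ‖w‖ < min 1 w₁) :
    qExp q (eta q) w + qExp q (eta q) (-w) ≠ 0 := by
  intro h
  have hw1 : ‖w‖ < 1 := hw.trans_le (min_le_left _ _)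
  have hw2 : ‖w‖ < w₁ := hw.trans_le (min_le_right _ _)
  have hs0 : 0 < q ^ (1 / 2 : ℝ) := Real.rpow_pos_of_pos hq0 _
  have hs1 := rpow_half_lt_one hq0 hq1
  have hsum : qPochInf (-w) (rootC q) + qPochInf w (rootC q) = 0 := by
    rw [qExp_eta hq0 hq1 hw1, qExp_eta hq0 hq1 (by rwa [norm_neg]), neg_sq, neg_neg, ← add_div,
      div_eq_zero_iff, or_iff_left (qPochInf_sq_ne_zero hq0 hq1 hw1).2] at h
    exact h
  have hnorm : ‖qPochInf (-w) (rootC q)‖ = ‖qPochInf w (rootC q)‖ := by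
    rw [eq_neg_of_add_eq_zero_left hsum, norm_neg]
  have hre : w.re = 0 := by
    rcases lt_trichotomy w.re 0 with h0 | h0 | h0
    · have := norm_qPochInf_lt hs0 hs1 (w := -w) (by simpa using h0) (by rwa [norm_neg])
      rw [neg_neg] at this
      exact absurd hnorm this.ne
    · exact h0
    · exact absurd hnorm (norm_qPochInf_lt hs0 hs1 h0 hw1).ne'
  have hw0 : w ≠ 0 := by
    rintro rfl
    simp [qPochInf] at hsum
  have hwI : w = Complex.I * ((w.im : ℝ) : ℂ) := by
    apply Complex.ext <;> simp [hre]
  have hnw : ‖w‖ = |w.im| := by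
    conv_lhs => rw [hwI]
    simp
  have hmem : ‖w‖ ∈ {w : ℝ | 0 < w ∧ qCosEta q w = 0} := by
    refine ⟨norm_pos_iff.mpr hw0, ?_⟩
    rw [qCosEta, if_pos (by rwa [abs_norm]), qCos, hnw]
    have hz : qExp q (eta q) (Complex.I * ((|w.im| : ℝ) : ℂ)) +
        qExp q (eta q) (-(Complex.I * ((|w.im| : ℝ) : ℂ))) = 0 := by
      rcases abs_choice w.im with h' | h'
      · rw [h', ← hwI, h]
      · rw [h', Complex.ofReal_neg, mul_neg, ← hwI, neg_neg, add_comm, h]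
    rw [hz, zero_div]
  exact absurd (hw₁.2 hmem) (not_le.mpr hw2)

/-! ### The expansion in `q`-Euler polynomials -/

/-- The rearrangement behind the expansion. All three series are sums of the same double family
`a (k + j) u k h j` with signs, and the signs satisfy
`1 + (-1) ^ j = (1 - (-1) ^ (k + j)) (-1) ^ j + (1 + (-1) ^ k)`. -/
lemma hasSum_rearrange {a b h u v B : ℕ → ℂ} {F : ℂ}
    (hM : Summable fun p : ℕ × ℕ => a (p.1 + p.2) * (u p.1 * h p.2))
    (hB : ∀ n, B n = ∑ kl ∈ Finset.HasAntidiagonal.antidiagonal n,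
      u kl.1 * ((1 + (-1) ^ kl.2) * h kl.2))
    (hv : ∀ n, v n = ∑ kl ∈ Finset.HasAntidiagonal.antidiagonal n,
      u kl.1 * (2 * ((-1) ^ kl.2 * h kl.2)))
    (hb : ∀ k, HasSum (fun j => a (k + j) * h j) (b k))
    (hF : HasSum (fun n => a n * B n) F) :
    ∃ S T : ℂ, HasSum (fun k => a (2 * k + 1) * v (2 * k + 1)) S ∧
      HasSum (fun k => u (2 * k) * b (2 * k)) T ∧ F = S + 2 * T := by
  have hsign : ∀ n : ℕ, ‖(-1 : ℂ) ^ n‖ = 1 := fun n => by simp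
  have hbd : ∀ ε : ℕ × ℕ → ℂ, (∀ p, ‖ε p‖ ≤ 2) →
      Summable fun p : ℕ × ℕ => ε p * (a (p.1 + p.2) * (u p.1 * h p.2)) := by
    intro ε hε
    refine Summable.of_norm_bounded (hM.norm.mul_left 2) fun p => ?_
    rw [norm_mul]
    exact mul_le_mul_of_nonneg_right (hε p) (norm_nonneg _)
  -- summation along antidiagonals
  have hanti : ∀ ε : ℕ × ℕ → ℂ, (∀ p, ‖ε p‖ ≤ 2) →
      HasSum (fun n => a n * ∑ kl ∈ Finset.HasAntidiagonal.antidiagonal n,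
        ε kl * (u kl.1 * h kl.2)) (∑' p : ℕ × ℕ, ε p * (a (p.1 + p.2) * (u p.1 * h p.2))) := by
    intro ε hε
    have h1 := (Finset.HasAntidiagonal.sigmaAntidiagonalEquivProd (A := ℕ)).hasSum_iff.mpr
      (hbd ε hε).hasSum
    refine (h1.sigma fun n => hasSum_fintype _).congr_fun fun n => ?_
    rw [Finset.mul_sum, ← Finset.sum_coe_sort]
    refine Finset.sum_congr rfl fun kl _ => ?_
    have := Finset.HasAntidiagonal.mem_antidiagonal.mp kl.2
    simp only [Function.comp, Finset.HasAntidiagonal.sigmaAntidiagonalEquivProd_apply, this]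
    ring
  have hε₁ : ∀ p : ℕ × ℕ, ‖(1 + (-1 : ℂ) ^ p.2)‖ ≤ 2 := fun p =>
    (norm_add_le _ _).trans (by rw [hsign, norm_one]; norm_num)
  have hε₂ : ∀ p : ℕ × ℕ, ‖(1 + (-1 : ℂ) ^ p.1)‖ ≤ 2 := fun p =>
    (norm_add_le _ _).trans (by rw [hsign, norm_one]; norm_num)
  have hε₃ : ∀ p : ℕ × ℕ, ‖(1 - (-1 : ℂ) ^ (p.1 + p.2)) * (-1) ^ p.2‖ ≤ 2 := fun p => by
    rw [norm_mul, hsign, mul_one]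
    exact (norm_sub_le _ _).trans (by rw [hsign, norm_one]; norm_num)
  have hF' : F = ∑' p : ℕ × ℕ, (1 + (-1 : ℂ) ^ p.2) * (a (p.1 + p.2) * (u p.1 * h p.2)) := by
    refine hF.unique ((hanti _ hε₁).congr_fun fun n => ?_)
    rw [hB]
    congr 1
    exact Finset.sum_congr rfl fun kl _ => by ring
  have hT : HasSum (fun k => (1 + (-1 : ℂ) ^ k) * (u k * b k))
      (∑' p : ℕ × ℕ, (1 + (-1 : ℂ) ^ p.1) * (a (p.1 + p.2) * (u p.1 * h p.2))) := by
    refine (hbd _ hε₂).hasSum.prod_fiberwise fun k => ?_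
    have := (hb k).mul_left ((1 + (-1 : ℂ) ^ k) * u k)
    rw [mul_assoc] at this
    exact this.congr_fun fun j => by ring
  have hS : HasSum (fun n => (1 - (-1 : ℂ) ^ n) / 2 * (a n * v n)) (∑' p : ℕ × ℕ,
      ((1 - (-1 : ℂ) ^ (p.1 + p.2)) * (-1) ^ p.2) * (a (p.1 + p.2) * (u p.1 * h p.2))) := by
    refine (hanti _ hε₃).congr_fun fun n => ?_
    rw [hv, Finset.mul_sum, Finset.mul_sum, Finset.mul_sum]
    refine Finset.sum_congr rfl fun kl hkl => ?_
    rw [Finset.HasAntidiagonal.mem_antidiagonal.mp hkl]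
    ring
  have hT2 : HasSum (fun k => 2 * (u (2 * k) * b (2 * k))) _ :=
    ((Function.Injective.hasSum_iff (g := fun k : ℕ => 2 * k) (fun i j hij => by simpa using hij)
      fun n hn => by
        rcases Nat.even_or_odd' n with ⟨m, rfl | rfl⟩
        · exact absurd ⟨m, rfl⟩ hn
        · simp [pow_succ, pow_mul]).mpr hT).congr_fun fun k => by
          simp only [Function.comp, pow_mul]
          norm_num
  have hS2 : HasSum (fun k => a (2 * k + 1) * v (2 * k + 1)) _ :=
    ((Function.Injective.hasSum_iff (g := fun k : ℕ => 2 * k + 1)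
      (fun i j hij => by simpa using hij) fun n hn => by
        rcases Nat.even_or_odd' n with ⟨m, rfl | rfl⟩
        · simp [pow_mul]
        · exact absurd ⟨m, rfl⟩ hn).mpr hS).congr_fun fun k => by
          simp only [Function.comp, pow_succ, pow_mul]
          norm_num
  refine ⟨_, _, hS2, (hT2.mul_left 2⁻¹).congr_fun fun k => by ring, ?_⟩
  rw [mul_inv_cancel_left₀ two_ne_zero, hF', ← (hbd _ hε₃).tsum_add (hbd _ hε₂)]
  refine tsum_congr fun p => ?_
  have e : ((-1 : ℂ) ^ p.2) * (-1) ^ p.2 = 1 := by rw [← mul_pow]; simp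
  rw [pow_add]
  linear_combination ((-1 : ℂ) ^ p.1 * (a (p.1 + p.2) * (u p.1 * h p.2))) * e

lemma exists_norm_le_of_limsup_lt {a : ℕ → ℂ} {t : ℝ} (ht0 : 0 < t)
    (h : limsup (fun n : ℕ => ((‖a n‖ ^ (1 / (n : ℝ)) : ℝ) : EReal)) atTop < (t : EReal)) :
    ∃ C : ℝ, ∀ n, ‖a n‖ ≤ C * t ^ n := by
  obtain ⟨N, hN⟩ := eventually_atTop.mp ((eventually_lt_of_limsup_lt h).and (eventually_ge_atTop 1))
  have hsum : 0 ≤ ∑ i ∈ Finset.range N, ‖a i‖ / t ^ i :=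
    Finset.sum_nonneg fun i _ => by positivity
  refine ⟨1 + ∑ i ∈ Finset.range N, ‖a i‖ / t ^ i, fun n => ?_⟩
  rcases lt_or_ge n N with hn | hn
  · rw [← div_le_iff₀ (by positivity)]
    have := Finset.single_le_sum (f := fun i => ‖a i‖ / t ^ i) (fun i _ => by positivity)
      (Finset.mem_range.mpr hn)
    linarith
  · obtain ⟨h1, h2⟩ := hN n hn
    have h3 := EReal.coe_lt_coe_iff.mp h1
    have h4 : ‖a n‖ ≤ t ^ n := by
      calc ‖a n‖ = (‖a n‖ ^ (1 / (n : ℝ))) ^ n := by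
            rw [one_div, Real.rpow_inv_natCast_pow (norm_nonneg _) (by omega)]
        _ ≤ t ^ n := by gcongr
    refine h4.trans (le_mul_of_one_le_left (by positivity) (by linarith))

lemma norm_div_gam_pow {q : ℝ} (hq0 : 0 < q) (hq1 : q < 1) (c : ℂ) (n : ℕ) :
    ((1 - q) / 2) ^ n * (‖c‖ * q ^ (-(n : ℝ) / 4)) = ‖c / (gam q : ℂ) ^ n‖ := by
  have h1 : 0 < 1 - q := by linarith
  have hp : 0 < q ^ (1 / 4 : ℝ) := Real.rpow_pos_of_pos hq0 _
  have hg : 0 < gam q := by unfold gam; positivity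
  have e : q ^ (-(n : ℝ) / 4) = ((q ^ (1 / 4 : ℝ)) ^ n)⁻¹ := by
    rw [← Real.rpow_natCast, ← Real.rpow_mul hq0.le, ← Real.rpow_neg hq0.le]
    congr 1; ring
  rw [norm_div, norm_pow, Complex.norm_real, Real.norm_of_nonneg hg.le, e, gam, div_pow, div_pow,
    mul_pow]
  field_simp

/-- Taylor coefficients at `η`: the shifted series of the Taylor coefficients at `0`. -/
lemma hasSum_askeyWilson_iterate_eta {q : ℝ} (hq0 : 0 < q) (hq1 : q < 1) {f : ℂ → ℂ}
    (hf : HasTaylorGrowth q f) (k : ℕ) :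
    HasSum (fun j => (askeyWilson q)^[k + j] f 0 / (gam q : ℂ) ^ (k + j) *
      rhoAppell q j (eta q)) ((askeyWilson q)^[k] f (eta q) / (gam q : ℂ) ^ k) := by
  have hη := isGeneric_eta hq0 hq1
  have h := hasSum_askeyWilson_iterate hq0 k
    (F := fun n y => (askeyWilson q)^[n] f 0 / (gam q : ℂ) ^ n * rhoAppell q n y)
    (fun y _ => hasSum_rhoAppell hq0 hq1 hf y) hη
  simp only [askeyWilson_iterate_const_mul hq0 _ _ _ hη,
    (isAppell_rhoAppell hq0 hq1).iterate hq0 _ _ hη] at h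
  have h2 := (Function.Injective.hasSum_iff (g := fun j : ℕ => k + j) (add_right_injective k)
    fun n hn => by
      rw [if_neg fun hkn => hn ⟨n - k, by simp only; omega⟩, mul_zero]).mpr h
  refine (h2.div_const _).congr_fun fun j => ?_
  have hg := pow_ne_zero k (gam_ne_zero hq0 hq1)
  simp only [Function.comp, Nat.le_add_right, if_true, Nat.add_sub_cancel_left]
  field_simp

lemma hasSum_qExp_eta_neg {q : ℝ} (hq0 : 0 < q) (hq1 : q < 1) {w : ℂ} (hw : ‖w‖ < 1) :
    HasSum (fun n => (-1) ^ n * rhoAppell q n (eta q) * w ^ n) (qExp q (eta q) (-w)) :=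
  (hasSum_qExp hq0 hq1 (eta q) (by rwa [norm_neg])).congr_fun fun n => by
    rw [neg_pow w]; ring

/-- The Taylor series defining `eulerS` converges on every disk around `0` that contains no zero of
its denominator. -/
lemma hasSum_eulerS {q : ℝ} (hq0 : 0 < q) (hq1 : q < 1) {r : ℝ} (hr0 : 0 < r) (hr1 : r ≤ 1)
    (hden : ∀ w : ℂ, ‖w‖ < r → qExp q (eta q) w + qExp q (eta q) (-w) ≠ 0) (x : ℂ) {w : ℂ}
    (hw : ‖w‖ < r) :
    HasSum (fun n => eulerS q n x * w ^ n)
      (qExp q x w / (qExp q (eta q) w + qExp q (eta q) (-w))) := by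
  have hE : ∀ y, DifferentiableOn ℂ (qExp q y) (Metric.ball 0 r) := fun y =>
    differentiableOn_of_hasSum hr0 fun w hw => hasSum_qExp hq0 hq1 y (hw.trans_le hr1)
  have hEn : DifferentiableOn ℂ (fun w => qExp q (eta q) (-w)) (Metric.ball 0 r) :=
    differentiableOn_of_hasSum hr0 fun w hw => hasSum_qExp_eta_neg hq0 hq1 (hw.trans_le hr1)
  have hd : DifferentiableOn ℂ
      (fun w => qExp q x w / (qExp q (eta q) w + qExp q (eta q) (-w))) (Metric.ball 0 r) :=
    (hE x).div ((hE (eta q)).add hEn) fun w hw => hden w (by simpa using hw)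
  refine (Complex.hasSum_taylorSeries_on_ball hd (z := w) (by simpa using hw)).congr_fun
    fun n => ?_
  rw [eulerS, sub_zero, smul_eq_mul, smul_eq_mul]
  ring

lemma rhoAppell_eq_sum_eulerS {q : ℝ} (hq0 : 0 < q) (hq1 : q < 1) {r : ℝ} (hr0 : 0 < r)
    (hr1 : r ≤ 1) (hden : ∀ w : ℂ, ‖w‖ < r → qExp q (eta q) w + qExp q (eta q) (-w) ≠ 0)
    (x : ℂ) (n : ℕ) :
    rhoAppell q n x = ∑ kl ∈ Finset.HasAntidiagonal.antidiagonal n,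
      eulerS q kl.1 x * ((1 + (-1) ^ kl.2) * rhoAppell q kl.2 (eta q)) := by
  rw [← coeff_eq_iteratedDeriv hr0
    (fun w hw => hasSum_qExp hq0 hq1 x (lt_of_lt_of_le hw hr1)) n]
  refine coeff_eq_iteratedDeriv (p := fun n => ∑ kl ∈ Finset.HasAntidiagonal.antidiagonal n,
      eulerS q kl.1 x * ((1 + (-1) ^ kl.2) * rhoAppell q kl.2 (eta q))) hr0 (fun w hw => ?_) n
  have hw1 := hw.trans_le hr1
  have h1 : HasSum (fun n => ((1 + (-1) ^ n) * rhoAppell q n (eta q)) * w ^ n)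
      (qExp q (eta q) w + qExp q (eta q) (-w)) :=
    ((hasSum_qExp hq0 hq1 (eta q) hw1).add (hasSum_qExp_eta_neg hq0 hq1 hw1)).congr_fun
      fun n => by ring
  have h2 := hasSum_mul_powerSeries (a := fun n => eulerS q n x)
    (b := fun n => (1 + (-1) ^ n) * rhoAppell q n (eta q))
    (hasSum_eulerS hq0 hq1 hr0 hr1 hden x hw) h1
  rwa [div_mul_cancel₀ _ (hden w hw)] at h2

lemma eulerT_eq_sum_eulerS {q : ℝ} (hq0 : 0 < q) (hq1 : q < 1) {r : ℝ} (hr0 : 0 < r)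
    (hr1 : r ≤ 1) (hden : ∀ w : ℂ, ‖w‖ < r → qExp q (eta q) w + qExp q (eta q) (-w) ≠ 0)
    (x : ℂ) (n : ℕ) :
    eulerT q n x = ∑ kl ∈ Finset.HasAntidiagonal.antidiagonal n,
      eulerS q kl.1 x * (2 * ((-1) ^ kl.2 * rhoAppell q kl.2 (eta q))) := by
  rw [eulerT]
  refine coeff_eq_iteratedDeriv (p := fun n => ∑ kl ∈ Finset.HasAntidiagonal.antidiagonal n,
      eulerS q kl.1 x * (2 * ((-1) ^ kl.2 * rhoAppell q kl.2 (eta q)))) hr0 (fun w hw => ?_) n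
  have h1 : HasSum (fun n => (2 * ((-1) ^ n * rhoAppell q n (eta q))) * w ^ n)
      (2 * qExp q (eta q) (-w)) :=
    ((hasSum_qExp_eta_neg hq0 hq1 (hw.trans_le hr1)).mul_left 2).congr_fun fun n => by ring
  have h2 := hasSum_mul_powerSeries (a := fun n => eulerS q n x)
    (b := fun n => 2 * ((-1) ^ n * rhoAppell q n (eta q)))
    (hasSum_eulerS hq0 hq1 hr0 hr1 hden x hw) h1
  rwa [div_mul_eq_mul_div, mul_comm (qExp q x w)] at h2

lemma exists_hasSum_euler {q : ℝ} (hq0 : 0 < q) (hq1 : q < 1) {f : ℂ → ℂ}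
    (hT : HasTaylorGrowth q f) {r : ℝ} (hr1 : r ≤ 1)
    (hden : ∀ w : ℂ, ‖w‖ < r → qExp q (eta q) w + qExp q (eta q) (-w) ≠ 0)
    {C t : ℝ} (ht0 : 0 < t) (ht : t < r)
    (hC : ∀ n, ‖(askeyWilson q)^[n] f 0 / (gam q : ℂ) ^ n‖ ≤ C * t ^ n) (x : ℂ) :
    ∃ S T : ℂ, HasSum (fun k : ℕ => (askeyWilson q)^[2 * k + 1] f 0 /
        (gam q : ℂ) ^ (2 * k + 1) * eulerT q (2 * k + 1) x) S ∧
      HasSum (fun k : ℕ => eulerS q (2 * k) x *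
        ((askeyWilson q)^[2 * k] f (eta q) / (gam q : ℂ) ^ (2 * k))) T ∧ f x = S + 2 * T := by
  have hr0 := ht0.trans ht
  have hM : Summable fun p : ℕ × ℕ => (askeyWilson q)^[p.1 + p.2] f 0 /
      (gam q : ℂ) ^ (p.1 + p.2) * (eulerS q p.1 x * rhoAppell q p.2 (eta q)) := by
    have htn : ‖(t : ℂ)‖ = t := by rw [Complex.norm_real, Real.norm_of_nonneg ht0.le]
    have htr : ‖(t : ℂ)‖ < r := by rwa [htn]
    have h1 := (hasSum_eulerS hq0 hq1 hr0 hr1 hden x htr).summable.norm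
    have h2 := (hasSum_qExp hq0 hq1 (eta q) (htr.trans_le hr1)).summable.norm
    refine Summable.of_norm_bounded ((h1.mul_of_nonneg h2 (fun _ => norm_nonneg _)
      fun _ => norm_nonneg _).mul_left C) fun p => ?_
    simp only [norm_mul, norm_pow, htn]
    calc _ ≤ (C * t ^ (p.1 + p.2)) * (‖eulerS q p.1 x‖ * ‖rhoAppell q p.2 (eta q)‖) :=
          mul_le_mul_of_nonneg_right (hC _) (by positivity)
      _ = _ := by rw [pow_add]; ring
  exact hasSum_rearrange (a := fun n => (askeyWilson q)^[n] f 0 / (gam q : ℂ) ^ n)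
    (b := fun k => (askeyWilson q)^[k] f (eta q) / (gam q : ℂ) ^ k)
    (h := fun n => rhoAppell q n (eta q)) (u := fun n => eulerS q n x)
    (v := fun n => eulerT q n x) (B := fun n => rhoAppell q n x) hM
    (rhoAppell_eq_sum_eulerS hq0 hq1 hr0 hr1 hden x)
    (eulerT_eq_sum_eulerS hq0 hq1 hr0 hr1 hden x)
    (hasSum_askeyWilson_iterate_eta hq0 hq1 hT) (hasSum_rhoAppell hq0 hq1 hT x)

end AskeyWilsonEuler

end

open AskeyWilsonEuler in
theorem theorem4p3 (q : ℝ) (hq0 : 0 < q) (hq1 : q < 1) (f : ℂ → ℂ)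
    (hf : (∃ k α : ℝ, k < 2 * Real.log q⁻¹ ∧ AskeyWilsonEuler.IsQExpGrowth q f k α) ∨
      (∃ α : ℝ, α < 2 * Real.log 2 / Real.log q⁻¹ ∧
        AskeyWilsonEuler.IsQExpGrowth q f (2 * Real.log q⁻¹) α)) :
    (∀ x : ℂ, HasSum
      (fun k : ℕ => AskeyWilsonEuler.taylorCoeff q f k * AskeyWilsonEuler.rho q k x) (f x)) ∧
    ∀ w₁ τ : ℝ, IsLeast {w : ℝ | 0 < w ∧ AskeyWilsonEuler.qCosEta q w = 0} w₁ →
      limsup (fun n : ℕ => (((((1 - q) / 2) ^ n *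
          (‖(AskeyWilsonEuler.askeyWilson q)^[n] f 0‖ * q ^ (-(n : ℝ) / 4))) ^ (1 / (n : ℝ)) : ℝ)
            : EReal)) atTop = (τ : EReal) →
      0 < τ → τ < min 1 w₁ →
      ∀ x : ℂ,
        Summable (fun k : ℕ => ((AskeyWilsonEuler.gam q : ℂ) ^ (2 * k + 1))⁻¹ *
          AskeyWilsonEuler.eulerT q (2 * k + 1) x *
          (AskeyWilsonEuler.askeyWilson q)^[2 * k + 1] f 0) ∧
        Summable (fun k : ℕ => ((AskeyWilsonEuler.gam q : ℂ) ^ (2 * k))⁻¹ *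
          AskeyWilsonEuler.eulerS q (2 * k) x *
          (AskeyWilsonEuler.askeyWilson q)^[2 * k] f (AskeyWilsonEuler.eta q)) ∧
        f x = (∑' k : ℕ, ((AskeyWilsonEuler.gam q : ℂ) ^ (2 * k + 1))⁻¹ *
            AskeyWilsonEuler.eulerT q (2 * k + 1) x *
            (AskeyWilsonEuler.askeyWilson q)^[2 * k + 1] f 0) +
          2 * ∑' k : ℕ, ((AskeyWilsonEuler.gam q : ℂ) ^ (2 * k))⁻¹ *
            AskeyWilsonEuler.eulerS q (2 * k) x *
            (AskeyWilsonEuler.askeyWilson q)^[2 * k] f (AskeyWilsonEuler.eta q) := by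
  have hT := hasTaylorGrowth_of_isQExpGrowth hq0 hq1 hf
  refine ⟨fun x => (hasSum_rhoAppell hq0 hq1 hT x).congr_fun fun k =>
    taylorCoeff_mul_rho hq0 f k x, fun w₁ τ hw₁ hlim hτ0 hτ x => ?_⟩
  obtain ⟨t, hτt, ht⟩ := exists_between hτ
  have ht0 : 0 < t := hτ0.trans hτt
  simp only [norm_div_gam_pow hq0 hq1] at hlim
  obtain ⟨C, hC⟩ := exists_norm_le_of_limsup_lt ht0
    (hlim.trans_lt (EReal.coe_lt_coe_iff.mpr hτt))
  obtain ⟨S, T, hS, hT', hF⟩ := exists_hasSum_euler hq0 hq1 hT (min_le_left 1 w₁)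
    (fun w hw => qExp_eta_add_ne_zero hq0 hq1 hw₁ hw) ht0 ht hC x
  have hS' := hS.congr_fun (g := fun k : ℕ => ((gam q : ℂ) ^ (2 * k + 1))⁻¹ *
    eulerT q (2 * k + 1) x * (askeyWilson q)^[2 * k + 1] f 0) fun k => by
      rw [div_eq_mul_inv]; ring
  have hT'' := hT'.congr_fun (g := fun k : ℕ => ((gam q : ℂ) ^ (2 * k))⁻¹ *
    eulerS q (2 * k) x * (askeyWilson q)^[2 * k] f (eta q)) fun k => by
      rw [div_eq_mul_inv]; ring
  exact ⟨hS'.summable, hT''.summable, by rw [hS'.tsum_eq, hT''.tsum_eq, hF]⟩
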